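/- Let $E=\mathbb{Q}(\sqrt{-87})$, with ring of integers $\mathcal{O}=\mathbb{Z}+\mathbb{Z}\omega$, $\omega=(1+\sqrt{-87})/2$. A Hermitian space $(V,h)$ over $E$ is an $E$-vector space $V$ with a map $h:V\times V\to E$ that is linear in the first variable and satisfies $h(x,y)=\overline{h(y,x)}$. A Hermitian lattice is a finitely generated $\mathcal{O}$-submodule $L$ of such a space; it is positive definite integral if $h(x,x)\in\mathbb{Z}_{>0}$ for all nonzero $x\in L$ and $h(x,y)\in\mathcal{O}$ for all $x,y\in L$, and unary if $\dim_E EL=1$. A lattice $L$ is represented by a lattice $K$ if there is an injective $\mathcal{O}$-linear map $L\to K$ preserving the Hermitian maps; $L$ and $K$ are isometric if there is a bijective such map. Let $I_m$ be the free Hermitian $\mathcal{O}$-lattice with an orthonormal basis of $m$ vectors, let $\mathfrak{S}_{87}(1)$ be the set of all positive definite integral unary Hermitian $\mathcal{O}$-lattices that are represented by $I_m$ for some $m\ge1$, and let $g_{87}(1)$ be the least positive integer $g$ such that every lattice in $\mathfrak{S}_{87}(1)$ is represented by $I_g$. Put $\mathfrak{P}_1=\mathcal{O}$, $\mathfrak{P}_2=\mathcal{O}2+\mathcal{O}(-1+\omega)$,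 $\mathfrak{P}_3=\mathcal{O}7+\mathcal{O}(2+\omega)$, $\mathfrak{P}_4=\mathcal{O}3+\mathcal{O}(1+\omega)$, $\mathfrak{P}_5=\mathcal{O}7+\mathcal{O}(4+\omega)$, $\mathfrak{P}_6=\mathcal{O}2+\mathcal{O}\omega$, and $(p_1,\dots,p_6)=(1,2,7,3,7,2)$. For an integer $r\ge1$ let $\mathfrak{P}_iv_i^{r}$ be the unary Hermitian lattice on a one-dimensional space $Ev_i^r$ with $h(v_i^{r},v_i^{r})=r/p_i$. Put $X_1=\emptyset$, $X_2=X_6=\{1,3,5,7,9\}$, $X_3=X_5=\{1,2,3,5,9\}$, $X_4=\{1,2,4,5,7,10,13\}$. Then: 1. $E$ has class number $6$; the ideals $\mathfrak{P}_2,\dots,\mathfrak{P}_6$ are prime, each $\mathfrak{P}_i$ has absolute norm $p_i$, and every ideal class of $E$ contains exactly one of $\mathfrak{P}_1,\dots,\mathfrak{P}_6$. 2. Up to isometry, $$\mathfrak{S}_{87}(1)=\bigcup_{i=1}^{6}\{\mathfrak{P}_iv_i^{r}: r\ge1,\ r\notin X_i\},$$ that is, a Hermitian lattice belongs to $\mathfrak{S}_{87}(1)$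 if and only if it is isometric to $\mathfrak{P}_iv_i^{r}$ for some $i$ and some $r\ge1$ with $r\notin X_i$. In particular, all $\mathcal{O}v_1^r$, $r\ge1$, belong to $\mathfrak{S}_{87}(1)$. 3. The positive definite integral unary Hermitian lattices that do not belong to $\mathfrak{S}_{87}(1)$ are exactly those isometric to $\mathfrak{P}_iv_i^{r}$ for some $i$ and some $r\in X_i$. 4. $g_{87}(1)=4$. -/

import Mathlib

open scoped NumberField nonZeroDivisors

universe u v

noncomputable section

/-- The imaginary quadratic field `ℚ(√-d)`: the elements are `x + y √-d` with `x y : ℚ`,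
and `star` is complex conjugation. -/
abbrev ImagQuadField (d : ℕ) : Type := QuadraticAlgebra ℚ (-(d : ℚ)) 0

instance ImagQuadField.factNotRoot (d : ℕ) [NeZero d] :
    Fact (∀ r : ℚ, r ^ 2 ≠ -(d : ℚ) + 0 * r) :=
  ⟨fun r h => by
    have hd : (0 : ℚ) < d := by exact_mod_cast Nat.pos_of_ne_zero (NeZero.ne d)
    nlinarith [sq_nonneg r]⟩

instance ImagQuadField.charZero (d : ℕ) [NeZero d] : CharZero (ImagQuadField d) :=
  charZero_of_injective_algebraMap (algebraMap ℚ (ImagQuadField d)).injective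

instance ImagQuadField.numberField (d : ℕ) [NeZero d] : NumberField (ImagQuadField d) where
  to_charZero := inferInstance
  to_finiteDimensional := by
    have h : Module.Finite ℚ (ImagQuadField d) := inferInstance
    convert h

/-- A Hermitian lattice over the ring of integers of `E = ℚ(√-d)`: a finitely generated
`𝓞 E`-submodule of a Hermitian space `(V, h)` over `E`; `h` is linear in the first and
conjugate-linear in the second variable. -/
structure HermitianLattice (d : ℕ) [NeZero d] where
  V : Type u
  [addCommGroup : AddCommGroup V]
  [module : Module (ImagQuadField d) V]
  [moduleInt : Module (𝓞 (ImagQuadField d)) V]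
  [tower : IsScalarTower (𝓞 (ImagQuadField d)) (ImagQuadField d) V]
  h : V →ₗ[ImagQuadField d] V →ₛₗ[starRingEnd (ImagQuadField d)] ImagQuadField d
  h_symm : ∀ x y : V, h x y = star (h y x)
  lattice : Submodule (𝓞 (ImagQuadField d)) V
  fg : lattice.FG

namespace HermitianLattice

attribute [instance] addCommGroup module moduleInt tower

variable {d : ℕ} [NeZero d]

/-- `h(x, x)` is a positive integer for all nonzero `x ∈ L`, and `h(x, y) ∈ 𝓞 E` for all
`x, y ∈ L`. -/
def IsPosDefIntegral (L : HermitianLattice.{u} d) : Prop :=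
  (∀ x ∈ L.lattice, x ≠ 0 → ∃ n : ℕ, 0 < n ∧ L.h x x = (n : ImagQuadField d)) ∧
  ∀ x ∈ L.lattice, ∀ y ∈ L.lattice, ∃ z : 𝓞 (ImagQuadField d), L.h x y = (z : ImagQuadField d)

/-- The space `E L` spanned by the lattice is one-dimensional. -/
def IsUnary (L : HermitianLattice.{u} d) : Prop :=
  Module.finrank (ImagQuadField d)
    (Submodule.span (ImagQuadField d) (L.lattice : Set L.V)) = 1

/-- `L → K`: there is an injective linear map from `L` to `K` preserving the Hermitian maps. -/
def IsRepresentedBy (L : HermitianLattice.{u} d) (K : HermitianLattice.{v} d) : Prop :=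
  ∃ σ : L.lattice →ₗ[𝓞 (ImagQuadField d)] K.lattice, Function.Injective σ ∧
    ∀ x y : L.lattice, K.h (σ x : K.V) (σ y : K.V) = L.h (x : L.V) (y : L.V)

/-- `L ≅ K`: there is a bijective linear map from `L` to `K` preserving the Hermitian maps. -/
def IsIsometricTo (L : HermitianLattice.{u} d) (K : HermitianLattice.{v} d) : Prop :=
  ∃ σ : L.lattice →ₗ[𝓞 (ImagQuadField d)] K.lattice, Function.Bijective σ ∧
    ∀ x y : L.lattice, K.h (σ x : K.V) (σ y : K.V) = L.h (x : L.V) (y : L.V)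

variable (d)

/-- `I_m`: the free lattice with an orthonormal basis of `m` vectors, that is, the standard
lattice in `E^m` with `h(x, y) = ∑ x_i * conj y_i`. -/
def I (m : ℕ) : HermitianLattice.{0} d where
  V := Fin m → ImagQuadField d
  h := LinearMap.mk₂'ₛₗ (RingHom.id (ImagQuadField d)) (starRingEnd (ImagQuadField d))
    (fun x y => ∑ i, x i * star (y i))
    (fun x x' y => by simp [add_mul, Finset.sum_add_distrib])
    (fun c x y => by simp [Finset.mul_sum, mul_assoc])
    (fun x y y' => by simp [mul_add, Finset.sum_add_distrib])
    (fun c x y => by simp [Finset.mul_sum, mul_left_comm, starRingEnd_apply])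
  h_symm x y := by simp [star_sum, star_mul']; simp [mul_comm]
  lattice := Submodule.span (𝓞 (ImagQuadField d))
    (Set.range fun i : Fin m => (Pi.single i 1 : Fin m → ImagQuadField d))
  fg := Submodule.fg_span (Set.finite_range _)

variable {d} in
/-- The unary lattice `𝔓 v` with `h(v) = q`, realised in `V = E` with `v = 1`, so that
`h(x, y) = q * x * conj y`. -/
def ofIdeal (P : Ideal (𝓞 (ImagQuadField d))) (q : ℚ) : HermitianLattice.{0} d where
  V := ImagQuadField d
  h := LinearMap.mk₂'ₛₗ (RingHom.id (ImagQuadField d)) (starRingEnd (ImagQuadField d))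
    (fun x y => algebraMap ℚ (ImagQuadField d) q * (x * star y))
    (fun x x' y => by ring)
    (fun c x y => by simp only [smul_eq_mul, RingHom.id_apply]; ring)
    (fun x y y' => by simp only [star_add]; ring)
    (fun c x y => by simp only [smul_eq_mul, star_mul', starRingEnd_apply]; ring)
  h_symm x y := by
    have : star (algebraMap ℚ (ImagQuadField d) q) = algebraMap ℚ (ImagQuadField d) q := by
      ext <;> simp
    simp only [LinearMap.mk₂'ₛₗ_apply, star_mul', star_star, this]; ring
  lattice := Submodule.map
    (Algebra.linearMap (𝓞 (ImagQuadField d)) (ImagQuadField d)) P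
  fg := Submodule.FG.map _ (IsNoetherian.noetherian P)

theorem I_h_apply (m : ℕ) (x y : Fin m → ImagQuadField d) :
    (I d m).h x y = ∑ i, x i * star (y i) := rfl

variable {d} in
theorem ofIdeal_h_apply (P : Ideal (𝓞 (ImagQuadField d))) (q : ℚ) (x y : ImagQuadField d) :
    (ofIdeal P q).h x y = algebraMap ℚ (ImagQuadField d) q * (x * star y) := rfl

end HermitianLattice

/-- `𝔖_d(1)`: the positive definite integral unary Hermitian lattices over the ring of integers
of `ℚ(√-d)` that are represented by some `I_m`, `m ≥ 1`. -/
def frakS (d : ℕ) [NeZero d] : Set (HermitianLattice.{u} d) :=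
  {L | L.IsPosDefIntegral ∧ L.IsUnary ∧
    ∃ m : ℕ, 0 < m ∧ L.IsRepresentedBy (HermitianLattice.I d m)}

/-- `g` is the least positive integer such that every lattice in `𝔖_d(1)` is represented by
`I_g`. -/
def IsGInvariant (d : ℕ) [NeZero d] (g : ℕ) : Prop :=
  IsLeast {g : ℕ | 0 < g ∧
    ∀ L ∈ frakS.{u} d, L.IsRepresentedBy (HermitianLattice.I d g)} g

namespace Field87

/-- `ω = (1 + √-87) / 2`. -/
def omega : 𝓞 (ImagQuadField 87) :=
  ⟨⟨1 / 2, 1 / 2⟩, by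
    refine ⟨Polynomial.X ^ 2 - Polynomial.X + Polynomial.C 22, ?_, ?_⟩
    · monicity!
    · have h22 : (algebraMap ℤ (ImagQuadField 87)) 22 = ⟨22, 0⟩ := by
        rw [eq_intCast]; rfl
      rw [Polynomial.eval₂_add, Polynomial.eval₂_sub, Polynomial.eval₂_pow, Polynomial.eval₂_X,
        Polynomial.eval₂_C, h22, pow_two]
      ext <;> simp <;> norm_num⟩

/-- The representatives `𝔓₁, …, 𝔓₆` of the ideal classes of `ℚ(√-87)`. -/
def P : Fin 6 → Ideal (𝓞 (ImagQuadField 87)) :=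
  ![⊤, Ideal.span {2, -1 + omega}, Ideal.span {7, 2 + omega}, Ideal.span {3, 1 + omega},
    Ideal.span {7, 4 + omega}, Ideal.span {2, omega}]

/-- The norms of the ideals `𝔓₁, …, 𝔓₆`. -/
def p : Fin 6 → ℕ := ![1, 2, 7, 3, 7, 2]

/-- The lattice `𝔓ᵢ v` with `h(v) = r / pᵢ`. -/
def lat (i : Fin 6) (r : ℕ) : HermitianLattice.{0} 87 :=
  HermitianLattice.ofIdeal (P i) ((r : ℚ) / (p i : ℚ))

/-- The excluded values of `r` for `𝔓₁, …, 𝔓₆`. -/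
def excluded : Fin 6 → Finset ℕ :=
  ![∅, {1, 3, 5, 7, 9}, {1, 2, 3, 5, 9}, {1, 2, 4, 5, 7, 10, 13}, {1, 2, 3, 5, 9},
    {1, 3, 5, 7, 9}]

end Field87

end

-- Write `E` for the field and `q_i` for the form `qf i`, which is the norm form of `P i` divided by
-- `p i`. The proof turns the theorem into a question about sums of values of these binary forms.
--
-- Classification. In a positive definite integral unary lattice choose a vector `v` of minimal
-- norm. The lattice is then `J v`, where `J ⊂ E` contains `1` and every nonzero element of `J` has
-- norm at least `1`. Gauss reduction (`exists_eq_inv_mul_Q`) gives `J = a⁻¹ (a, n + ω)` with `a ≤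
-- 5` and `a ∣ n² + n + 22`, and the few solutions are all multiples of some `P i`
-- (`exists_eq_mul_P`). Integrality of a single inner product forces the scale to be `r / p i`
-- (`exists_isIsometricTo_lat`). The same reduction, applied to an ideal divided by an element of
-- minimal norm, shows that the `P i` meet every ideal class. They lie in distinct classes because a
-- vector of minimal norm in `P i` is unique up to sign, so an equivalence would have to match these
-- vectors (`mk0_P_injective`).
--
-- Representation. The inverse of `P i` is its conjugate divided by `p i`. A map from the lattice to
-- `I_m` is therefore given by `m` elements of `P i`, and it is isometric exactly when `r` is a sum
-- of `m` values of `q_i` (`lat_isRepresentedBy_I_iff`).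
--
-- Arithmetic. If `r` is not excluded, four values suffice: fixing the second variables and
-- completing squares leaves a sum of four squares with congruence conditions, and Lagrange's
-- theorem for a number in a suitable class modulo 4 or 8 meets these automatically. If `r` is
-- excluded, no number of values suffices: the non-excluded nonnegative integers contain all values
-- of `q_i` and are closed under addition (`sum_qf_ne_of_mem_excluded`). Finally, four is optimal
-- because 7 is not a sum of three values of `x² + xy + 22y²`.

universe w

/-! ### Isometries, representations and change of universe -/

namespace HermitianLattice

variable {d : ℕ} [NeZero d]

theorem IsIsometricTo.symm {L : HermitianLattice.{u} d} {K : HermitianLattice.{v} d}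
    (h : L.IsIsometricTo K) : K.IsIsometricTo L := by
  obtain ⟨σ, hσ, hh⟩ := h
  let e := LinearEquiv.ofBijective σ hσ
  refine ⟨e.symm.toLinearMap, e.symm.bijective, fun x y => ?_⟩
  obtain ⟨x, rfl⟩ := e.surjective x
  obtain ⟨y, rfl⟩ := e.surjective y
  simp only [LinearEquiv.coe_coe, LinearEquiv.symm_apply_apply]
  exact (hh x y).symm

theorem IsIsometricTo.trans_isRepresentedBy {L : HermitianLattice.{u} d}
    {K : HermitianLattice.{v} d} {M : HermitianLattice.{w} d} (h : L.IsIsometricTo K)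
    (h' : K.IsRepresentedBy M) : L.IsRepresentedBy M := by
  obtain ⟨σ, hσ, hh⟩ := h
  obtain ⟨τ, hτ, hh'⟩ := h'
  refine ⟨τ ∘ₗ σ, hτ.comp hσ.injective, fun x y => ?_⟩
  rw [← hh, ← hh']; rfl

/-- The copy of a lattice in another universe. -/
noncomputable def uliftLattice (K : HermitianLattice.{v} d) : HermitianLattice.{max u v} d where
  V := ULift.{u} K.V
  h := LinearMap.mk₂'ₛₗ (RingHom.id (ImagQuadField d)) (starRingEnd (ImagQuadField d))
    (fun x y => K.h x.down y.down)
    (fun x x' y => by simp) (fun c x y => by simp) (fun x y y' => by simp) (fun c x y => by simp)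
  h_symm x y := K.h_symm x.down y.down
  lattice := K.lattice.map
    (ULift.moduleEquiv (R := 𝓞 (ImagQuadField d)) (M := K.V)).symm.toLinearMap
  fg := K.fg.map _

theorem uliftLattice_isIsometricTo (K : HermitianLattice.{v} d) :
    (uliftLattice.{u} K).IsIsometricTo K := by
  refine IsIsometricTo.symm ?_
  let e := (ULift.moduleEquiv (R := 𝓞 (ImagQuadField d)) (M := K.V)).symm.submoduleMap K.lattice
  exact ⟨e.toLinearMap, e.bijective, fun x y => rfl⟩

end HermitianLattice

/-! ### Integral coordinates `s + t ω` and the norm -/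

namespace Field87

/-- The field `ℚ(√-87)`. -/
abbrev E : Type := ImagQuadField 87

local notation "ι" => algebraMap (𝓞 E) E

theorem algebraMap_rat (q : ℚ) : algebraMap ℚ E q = ⟨q, 0⟩ :=
  RingHom.congr_fun (RingHom.ext_rat (algebraMap ℚ E)
    (@algebraMap ℚ E _ _ (QuadraticAlgebra.instAlgebra))) q

/-- The integer `s + t ω`. -/
noncomputable def el (s t : ℤ) : 𝓞 E := s + t * omega

theorem coe_omega : ι omega = ⟨1 / 2, 1 / 2⟩ := rfl

theorem coe_el (s t : ℤ) : ι (el s t) = ⟨s + t / 2, t / 2⟩ := by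
  simp only [el, map_add, map_mul, map_intCast]
  rw [coe_omega]
  ext <;> simp [QuadraticAlgebra.re_intCast, QuadraticAlgebra.im_intCast] <;> ring

theorem omega_sq : omega * omega = omega - 22 := by
  apply NumberField.RingOfIntegers.coe_injective
  simp only [map_mul, map_sub, map_ofNat]
  rw [coe_omega]
  ext <;> norm_num [QuadraticAlgebra.re_ofNat, QuadraticAlgebra.im_ofNat]

theorem el_add (s t s' t' : ℤ) : el s t + el s' t' = el (s + s') (t + t') := by
  simp only [el]; push_cast; ring

theorem el_sub (s t s' t' : ℤ) : el s t - el s' t' = el (s - s') (t - t') := by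
  simp only [el]; push_cast; ring

theorem el_neg (s t : ℤ) : -el s t = el (-s) (-t) := by
  simp only [el]; push_cast; ring

theorem el_mul (s t s' t' : ℤ) :
    el s t * el s' t' = el (s * s' - 22 * (t * t')) (s * t' + t * s' + t * t') := by
  simp only [el]; push_cast
  linear_combination (t * t' : 𝓞 E) * omega_sq

theorem el_intCast (s : ℤ) : (s : 𝓞 E) = el s 0 := by simp [el]

theorem el_zero : (0 : 𝓞 E) = el 0 0 := by simp [el]

theorem el_omega : omega = el 0 1 := by simp [el]

theorem el_inj {s t s' t' : ℤ} : el s t = el s' t' ↔ s = s' ∧ t = t' := by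
  refine ⟨fun h => ?_, by rintro ⟨rfl, rfl⟩; rfl⟩
  have h1 : ι (el s t) = ι (el s' t') := by rw [h]
  rw [coe_el, coe_el, QuadraticAlgebra.mk.injEq] at h1
  have ht : (t : ℚ) = t' := by linarith [h1.2]
  have hs : (s : ℚ) = s' := by linarith [h1.1, h1.2]
  exact ⟨by exact_mod_cast hs, by exact_mod_cast ht⟩

theorem isIntegral_star {x : E} (hx : IsIntegral ℤ x) : IsIntegral ℤ (star x) := by
  obtain ⟨f, hf, h⟩ := hx
  refine ⟨f, hf, ?_⟩
  have := congrArg (starRingEnd E) h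
  rw [map_zero, Polynomial.hom_eval₂] at this
  rw [← this, RingHom.ext_int ((starRingEnd E).comp (algebraMap ℤ E)) (algebraMap ℤ E)]
  rfl

theorem exists_int_of_isIntegral {q : ℚ} {x : E} (hq : x = ⟨q, 0⟩) (hx : IsIntegral ℤ x) :
    ∃ n : ℤ, q = n := by
  have h1 : x = algebraMap ℚ E q := by rw [hq, algebraMap_rat]
  rw [h1] at hx
  have h2 : IsIntegral ℤ q := by
    obtain ⟨f, hf, h⟩ := hx
    refine ⟨f, hf, ?_⟩
    apply (algebraMap ℚ E).injective
    rw [map_zero, Polynomial.hom_eval₂, ← h,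
      RingHom.ext_int ((algebraMap ℚ E).comp (algebraMap ℤ ℚ)) (algebraMap ℤ E)]
  obtain ⟨n, hn⟩ := IsIntegrallyClosed.isIntegral_iff.mp h2
  exact ⟨n, by simpa using hn.symm⟩

/-- Trace `a` and norm `m` are integers, so `87 (2 im x)²` is one too. Since 87 is squarefree, `b =
2 im x` is an integer, and `a² + 87 b² = 4m` forces `a` and `b` to have the same parity. -/
theorem exists_coords_of_isIntegral {x : E} (hx : IsIntegral ℤ x) :
    ∃ s t : ℤ, x = ⟨s + t / 2, t / 2⟩ := by
  obtain ⟨a, ha⟩ := exists_int_of_isIntegral (q := 2 * x.re) (x := x + star x)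
    (by ext <;> simp; ring) (hx.add (isIntegral_star hx))
  obtain ⟨m, hm⟩ := exists_int_of_isIntegral (q := x.re ^ 2 + 87 * x.im ^ 2) (x := x * star x)
    (by ext <;> simp <;> ring) (hx.mul (isIntegral_star hx))
  have hsq : (87 : ℚ) * (2 * x.im) ^ 2 = ((4 * m - a ^ 2 : ℤ) : ℚ) := by
    push_cast
    rw [← hm, ← ha]; ring
  have hb : ∃ b : ℤ, 2 * x.im = b := by
    have h1 : (87 * (2 * x.im)) ^ 2 = ((87 * (4 * m - a ^ 2) : ℤ) : ℚ) := by
      push_cast at hsq ⊢; rw [← hsq]; ring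
    obtain ⟨c, hc⟩ : ∃ c : ℤ, 87 * (2 * x.im) = c := by
      have h2 : IsIntegral ℤ (87 * (2 * x.im)) := by
        refine IsIntegral.of_pow (n := 2) (by norm_num) ?_
        rw [h1]
        exact isIntegral_algebraMap (R := ℤ) (A := ℚ) (x := 87 * (4 * m - a ^ 2))
      obtain ⟨n, hn⟩ := IsIntegrallyClosed.isIntegral_iff.mp h2
      exact ⟨n, by simpa using hn.symm⟩
    rw [hc] at h1
    have h3 : c ^ 2 = 87 * (4 * m - a ^ 2) := by exact_mod_cast h1
    have d3 : (3 : ℤ) ∣ c := Int.prime_three.dvd_of_dvd_pow (n := 2) ⟨29 * (4 * m - a ^ 2), by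
      rw [h3]; ring⟩
    have d29 : (29 : ℤ) ∣ c :=
      (Nat.prime_iff_prime_int.mp (by norm_num : Nat.Prime 29)).dvd_of_dvd_pow (n := 2)
        ⟨3 * (4 * m - a ^ 2), by rw [h3]; push_cast; ring⟩
    obtain ⟨b, hb⟩ : (87 : ℤ) ∣ c := by omega
    refine ⟨b, ?_⟩
    rw [hb] at hc; push_cast at hc; linarith
  obtain ⟨b, hb⟩ := hb
  have hpar : 87 * b ^ 2 = 4 * m - a ^ 2 := by
    rw [hb] at hsq; exact_mod_cast hsq
  have h2 : (2 : ℤ) ∣ a - b := by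
    rcases Int.even_or_odd' a with ⟨k, rfl | rfl⟩ <;> rcases Int.even_or_odd' b with ⟨l, rfl | rfl⟩
    · omega
    · ring_nf at hpar; omega
    · ring_nf at hpar; omega
    · omega
  obtain ⟨s, hs⟩ := h2
  have hs' : (a : ℚ) - b = 2 * s := by exact_mod_cast hs
  refine ⟨s, b, ?_⟩
  ext
  · show x.re = s + b / 2
    linarith
  · show x.im = b / 2
    linarith

theorem exists_el (z : 𝓞 E) : ∃ s t : ℤ, z = el s t := by
  obtain ⟨s, t, h⟩ := exists_coords_of_isIntegral z.isIntegral_coe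
  exact ⟨s, t, NumberField.RingOfIntegers.coe_injective (by rw [coe_el, ← h])⟩

/-- The norm form `u² + 87 v²` of `u + v √-87`. -/
def nm (x : E) : ℚ := x.re ^ 2 + 87 * x.im ^ 2

theorem mul_star_self (x : E) : x * star x = algebraMap ℚ E (nm x) := by
  rw [algebraMap_rat]
  ext <;> simp [nm] <;> ring

theorem nm_mul (x y : E) : nm (x * y) = nm x * nm y := by
  simp only [nm, QuadraticAlgebra.re_mul, QuadraticAlgebra.im_mul]
  push_cast; ring

theorem nm_eq_zero {x : E} : nm x = 0 ↔ x = 0 := by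
  constructor
  · intro h
    have h1 : x.re = 0 := by
      simp only [nm] at h; nlinarith [sq_nonneg x.re, sq_nonneg x.im]
    have h2 : x.im = 0 := by
      simp only [nm] at h; nlinarith [sq_nonneg x.re, sq_nonneg x.im]
    ext <;> simpa
  · rintro rfl; simp [nm]

theorem nm_nonneg (x : E) : 0 ≤ nm x := by
  simp only [nm]; positivity

theorem nm_pos {x : E} (hx : x ≠ 0) : 0 < nm x :=
  lt_of_le_of_ne (nm_nonneg x) fun h => hx (nm_eq_zero.mp h.symm)

theorem nm_el (s t : ℤ) : nm (ι (el s t)) = ((s ^ 2 + s * t + 22 * t ^ 2 : ℤ) : ℚ) := by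
  rw [coe_el]; simp only [nm]; push_cast; ring

theorem star_el (s t : ℤ) : star (ι (el s t)) = ι (el (s + t) (-t)) := by
  rw [coe_el, coe_el]
  ext <;> simp <;> ring

theorem ι_injective : Function.Injective ι := IsFractionRing.injective (𝓞 E) E

/-! ### The ideals `(a, n + ω)` and the representatives `P i` -/

/-- The ideal `(a, n + ω)`. -/
noncomputable def Q (a n : ℤ) : Ideal (𝓞 E) := Ideal.span {(a : 𝓞 E), el n 1}

/-- The norm of `n + ω` is `n² + n + 22`; as `a` divides it, `a` and `n + ω` already span the ideal
over `ℤ`. -/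
theorem el_mem_Q {a n : ℤ} (h : a ∣ n ^ 2 + n + 22) (s t : ℤ) :
    el s t ∈ Q a n ↔ a ∣ s - n * t := by
  rw [Q, Ideal.mem_span_pair]
  obtain ⟨k, hk⟩ := h
  constructor
  · rintro ⟨x, y, hxy⟩
    obtain ⟨x1, x2, rfl⟩ := exists_el x
    obtain ⟨y1, y2, rfl⟩ := exists_el y
    rw [el_intCast, el_mul, el_mul, el_add, el_inj] at hxy
    exact ⟨x1 - n * x2 - y2 * k, by linear_combination (-hxy.1) + n * hxy.2 - y2 * hk⟩
  · rintro ⟨m, hm⟩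
    refine ⟨el m 0, el t 0, ?_⟩
    rw [el_intCast, el_mul, el_mul, el_add, el_inj]
    constructor
    · linear_combination -hm
    · ring

theorem Q_congr {a n n' : ℤ} (h : a ∣ n ^ 2 + n + 22) (hn : a ∣ n' - n) : Q a n = Q a n' := by
  have h' : a ∣ n' ^ 2 + n' + 22 := by
    obtain ⟨k, hk⟩ := hn
    obtain ⟨l, hl⟩ := h
    exact ⟨l + k * (n + n' + 1), by linear_combination hl + (n + n' + 1) * hk⟩
  ext z
  obtain ⟨s, t, rfl⟩ := exists_el z
  rw [el_mem_Q h, el_mem_Q h']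
  have : s - n' * t = (s - n * t) - (n' - n) * t := by ring
  rw [this, dvd_sub_left (hn.mul_right t)]

/-- `ℤ × ℤ → 𝓞`, `(s, t) ↦ s + t ω`. -/
noncomputable def elHom : ℤ × ℤ →+ 𝓞 E where
  toFun x := el x.1 x.2
  map_zero' := el_zero.symm
  map_add' _ _ := (el_add _ _ _ _).symm

theorem elHom_surjective : Function.Surjective elHom := fun z => by
  obtain ⟨s, t, rfl⟩ := exists_el z
  exact ⟨(s, t), rfl⟩

/-- `(s, t) ↦ s - n t` modulo `a`. -/
def residue (a : ℕ) (n : ℤ) : ℤ × ℤ →+ ZMod a where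
  toFun x := ((x.1 - n * x.2 : ℤ) : ZMod a)
  map_zero' := by simp
  map_add' x y := by push_cast [Prod.fst_add, Prod.snd_add]; ring

/-- In coordinates the ideal is the kernel of the surjection `(s, t) ↦ s - n t` onto `ZMod a`. -/
theorem absNorm_Q {a : ℕ} [NeZero a] {n : ℤ} (h : (a : ℤ) ∣ n ^ 2 + n + 22) :
    Ideal.absNorm (Q a n) = a := by
  rw [Ideal.absNorm_eq_index,
    ← AddSubgroup.index_comap_of_surjective _ elHom_surjective]
  have : AddSubgroup.comap elHom (Submodule.toAddSubgroup (Q a n)) = (residue a n).ker := by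
    ext ⟨s, t⟩
    rw [AddSubgroup.mem_comap, AddMonoidHom.mem_ker]
    change el s t ∈ Q a n ↔ ((s - n * t : ℤ) : ZMod a) = 0
    rw [el_mem_Q h, ZMod.intCast_zmod_eq_zero_iff_dvd]
  rw [this, AddSubgroup.index_ker, AddMonoidHom.range_eq_top.mpr, Nat.card_congr
    AddSubgroup.topEquiv.toEquiv, Nat.card_zmod]
  intro x
  refine ⟨((x.val : ℤ), 0), ?_⟩
  simp [residue]

/-- The residues `n` with `𝔓ᵢ = (pᵢ, n + ω)`. -/
def shift : Fin 6 → ℤ := ![0, -1, 2, 1, 4, 0]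

theorem p_dvd (i : Fin 6) : (p i : ℤ) ∣ shift i ^ 2 + shift i + 22 := by
  fin_cases i <;> simp [p, shift]

theorem p_pos (i : Fin 6) : 0 < p i := by fin_cases i <;> simp [p]

instance (i : Fin 6) : NeZero (p i) := ⟨(p_pos i).ne'⟩

theorem P_eq_Q (i : Fin 6) : P i = Q (p i) (shift i) := by
  fin_cases i
  · change (⊤ : Ideal (𝓞 E)) = Q (1 : ℕ) 0
    rw [Q, eq_comm, Ideal.eq_top_iff_one]
    exact Ideal.subset_span (by simp)
  · change Ideal.span {2, -1 + omega} = Q (2 : ℕ) (-1)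
    simp [Q, el]
  · change Ideal.span {7, 2 + omega} = Q (7 : ℕ) 2
    simp [Q, el]
  · change Ideal.span {3, 1 + omega} = Q (3 : ℕ) 1
    simp [Q, el]
  · change Ideal.span {7, 4 + omega} = Q (7 : ℕ) 4
    simp [Q, el]
  · change Ideal.span {2, omega} = Q (2 : ℕ) 0
    simp [Q, el]

theorem el_mem_P (i : Fin 6) (s t : ℤ) : el s t ∈ P i ↔ (p i : ℤ) ∣ s - shift i * t := by
  rw [P_eq_Q, el_mem_Q (p_dvd i)]

theorem absNorm_P (i : Fin 6) : Ideal.absNorm (P i) = p i := by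
  rw [P_eq_Q, absNorm_Q (p_dvd i)]

theorem isPrime_P (i : Fin 6) (hi : i ≠ 0) : (P i).IsPrime := by
  apply Ideal.isPrime_of_irreducible_absNorm
  rw [absNorm_P, Nat.irreducible_iff_nat_prime]
  revert hi
  fin_cases i <;> simp [p] <;> norm_num

theorem P_mem_nonZeroDivisors (i : Fin 6) : P i ∈ (Ideal (𝓞 E))⁰ := by
  rw [← Ideal.absNorm_ne_zero_iff_mem_nonZeroDivisors, absNorm_P]
  exact (p_pos i).ne'

/-! ### Reduction of lattices in `E` with minimal vector `1` -/

theorem sub_intCast_mem {J : Submodule (𝓞 E) E} (h1 : (1 : E) ∈ J) {c : E} (hc : c ∈ J) (m : ℤ) :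
    c - (m : E) ∈ J := by
  refine J.sub_mem hc ?_
  have := J.smul_mem (m : 𝓞 E) h1
  rwa [Algebra.smul_def, map_intCast, mul_one] at this

/-- Subtracting the nearest integer leaves a rational element of norm at most 1/4, which minimality
forces to vanish. -/
theorem re_eq_intCast_of_im_eq_zero {J : Submodule (𝓞 E) E} (h1 : (1 : E) ∈ J)
    (hmin : ∀ c ∈ J, c ≠ 0 → 1 ≤ nm c) {c : E} (hc : c ∈ J) (him : c.im = 0) :
    ∃ m : ℤ, c = m := by
  refine ⟨round c.re, ?_⟩
  by_contra hne
  have h2 := hmin _ (sub_intCast_mem h1 hc (round c.re)) (sub_ne_zero.mpr hne)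
  have h3 := abs_le.mp (abs_sub_round c.re)
  simp only [nm, QuadraticAlgebra.re_sub, QuadraticAlgebra.im_sub, him,
    QuadraticAlgebra.re_intCast, QuadraticAlgebra.im_intCast] at h2
  nlinarith

theorem nm_sub_round_le (c : E) : nm (c - (round c.re : ℤ)) ≤ 1 / 4 + 87 * c.im ^ 2 := by
  have h3 := abs_le.mp (abs_sub_round c.re)
  simp only [nm, QuadraticAlgebra.re_sub, QuadraticAlgebra.im_sub,
    QuadraticAlgebra.re_intCast, QuadraticAlgebra.im_intCast]
  nlinarith

/-- A lattice in `E` containing `1` as a vector of minimal norm is `a⁻¹ (a, n + ω)` for some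
`a ≤ 5`. -/
theorem exists_eq_inv_mul_Q {J : Submodule (𝓞 E) E} (h1 : (1 : E) ∈ J)
    (hmin : ∀ c ∈ J, c ≠ 0 → 1 ≤ nm c) :
    ∃ a n : ℤ, 0 < a ∧ a ≤ 5 ∧ a ∣ n ^ 2 + n + 22 ∧
      ∀ c : E, c ∈ J ↔ ∃ z ∈ Q a n, (a : E) * c = ι z := by
  let f : E →+ ℚ :=
    { toFun := fun c => 2 * c.im
      map_zero' := by simp
      map_add' := fun x y => by simp [mul_add] }
  have hω : ι omega ∈ J := by
    have := J.smul_mem omega h1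
    rwa [Algebra.smul_def, mul_one] at this
  -- The group of values `2 im c` is discrete: if `0 < 2 im c < 1/6`, translating `c` by an integer
  -- gives a nonzero element of norm at most `1/4 + 87/144 < 1`.
  obtain ⟨b, hb⟩ := AddSubgroup.cyclic_of_isolated_zero (H := J.toAddSubgroup.map f)
    (a := 1 / 6) (by norm_num) (by
      rw [Set.disjoint_left]
      rintro x ⟨c, hc, rfl⟩ ⟨hx0, hx1⟩
      change 0 < 2 * c.im at hx0
      change 2 * c.im < 1 / 6 at hx1
      have h2 := hmin _ (sub_intCast_mem h1 hc (round c.re)) (fun h => by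
        have := congrArg QuadraticAlgebra.im h
        simp only [QuadraticAlgebra.im_sub, QuadraticAlgebra.im_intCast,
          QuadraticAlgebra.im_zero] at this
        linarith)
      have h3 := nm_sub_round_le c
      nlinarith)
  have key : ∀ c ∈ J, ∃ k : ℤ, 2 * c.im = k * b := by
    intro c hc
    have : f c ∈ J.toAddSubgroup.map f := ⟨c, hc, rfl⟩
    rw [hb, ← AddSubgroup.zmultiples_eq_closure, AddSubgroup.mem_zmultiples_iff] at this
    obtain ⟨k, hk⟩ := this
    exact ⟨k, by rw [← zsmul_eq_mul, hk]; rfl⟩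
  -- Because `ω ∈ J` has `2 im ω = 1`, the generator is `± 1 / a` for a positive integer `a`; the
  -- sign is absorbed in `τ`.
  obtain ⟨a, τ₀, ha, hτ₀, hτim₀, haim⟩ : ∃ (a : ℤ) (τ : E), 0 < a ∧ τ ∈ J ∧ a * (2 * τ.im) = 1 ∧
      ∀ c ∈ J, ∃ k : ℤ, c.im = k * τ.im := by
    have hbm : b ∈ J.toAddSubgroup.map f := by
      rw [hb]; exact AddSubgroup.subset_closure rfl
    obtain ⟨τ, hτ, hτb⟩ := hbm
    change 2 * τ.im = b at hτb
    obtain ⟨k, hk⟩ := key _ hω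
    rw [coe_omega] at hk
    have hkb : (k : ℚ) * b = 1 := by rw [← hk]; norm_num
    have hk0 : k ≠ 0 := by rintro rfl; simp at hkb
    rcases lt_or_gt_of_ne hk0 with hk0 | hk0
    · refine ⟨-k, -τ, by omega, J.neg_mem hτ, ?_, fun c hc => ?_⟩
      · rw [QuadraticAlgebra.im_neg]; push_cast; rw [← hτb] at hkb; linarith
      · obtain ⟨l, hl⟩ := key c hc
        refine ⟨-l, ?_⟩
        rw [QuadraticAlgebra.im_neg]; push_cast; rw [← hτb] at hl; linarith
    · refine ⟨k, τ, hk0, hτ, ?_, fun c hc => ?_⟩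
      · rw [← hτb] at hkb; linarith
      · obtain ⟨l, hl⟩ := key c hc
        refine ⟨l, ?_⟩
        rw [← hτb] at hl; linarith
  -- The same estimate: `a ≥ 6` would give `im τ₀ ≤ 1/12`.
  have ha5 : a ≤ 5 := by
    have h2 := hmin _ (sub_intCast_mem h1 hτ₀ (round τ₀.re)) (fun h => by
      have := congrArg QuadraticAlgebra.im h
      simp only [QuadraticAlgebra.im_sub, QuadraticAlgebra.im_intCast,
        QuadraticAlgebra.im_zero] at this
      rw [sub_zero] at this
      rw [this] at hτim₀; simp at hτim₀)
    have h3 := h2.trans (nm_sub_round_le τ₀)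
    by_contra h6
    have h6 : (6 : ℚ) ≤ a := by exact_mod_cast (by omega : 6 ≤ a)
    have hpos : 0 < τ₀.im := by
      by_contra hneg
      nlinarith
    have : 12 * τ₀.im ≤ 1 := by nlinarith
    nlinarith
  have haQ : (a : ℚ) ≠ 0 := by exact_mod_cast ha.ne'
  obtain ⟨n, hn⟩ : ∃ n : ℤ, (a : E) * τ₀ - ι omega = n := by
    have hm : (a : E) * τ₀ ∈ J := by
      have := J.smul_mem (a : 𝓞 E) hτ₀
      rwa [Algebra.smul_def, map_intCast] at this
    apply re_eq_intCast_of_im_eq_zero h1 hmin (J.sub_mem hm hω)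
    rw [coe_omega]
    simp [QuadraticAlgebra.re_intCast, QuadraticAlgebra.im_intCast]
    linarith
  have haτ : (a : E) * τ₀ = ι (el n 1) := by
    rw [sub_eq_iff_eq_add] at hn
    rw [hn, el]; simp
  have haE : (a : E) ≠ 0 := by exact_mod_cast ha.ne'
  refine ⟨a, n, ha, ha5, ?_, ?_⟩
  -- Since `a τ₀ = n + ω` and `(ω - n - 1)(ω + n) = -(n² + n + 22)`, the element `(ω - n - 1) τ₀` of
  -- `J` is rational, hence an integer.
  · obtain ⟨m, hm⟩ : ∃ m : ℤ, omega • τ₀ - ((n + 1 : ℤ) : 𝓞 E) • τ₀ = m := by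
      apply re_eq_intCast_of_im_eq_zero h1 hmin
        (J.sub_mem (J.smul_mem _ hτ₀) (J.smul_mem _ hτ₀))
      have : (a : E) * (omega • τ₀ - ((n + 1 : ℤ) : 𝓞 E) • τ₀) = ι (el (-22 - n ^ 2 - n) 0) := by
        rw [← sub_smul, Algebra.smul_def, mul_left_comm, haτ, ← map_mul, el_omega, el_intCast,
          el_sub, el_mul]
        congr 2 <;> ring
      rw [coe_el] at this
      have := congrArg QuadraticAlgebra.im this
      simp only [QuadraticAlgebra.im_mul, QuadraticAlgebra.re_intCast,
        QuadraticAlgebra.im_intCast] at this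
      simpa [haQ] using this
    refine ⟨-m, ?_⟩
    have h5 : ι (el (-22 - n ^ 2 - n) 0) = ι (el (a * m) 0) := by
      rw [← sub_smul, Algebra.smul_def] at hm
      have : (a : E) * (ι (omega - ((n + 1 : ℤ) : 𝓞 E)) * τ₀) = a * m := by rw [hm]
      rw [mul_left_comm, haτ, ← map_mul, el_omega, el_intCast, el_sub, el_mul] at this
      have h6 : (a : E) * m = ι (el (a * m) 0) := by rw [← el_intCast]; simp
      rw [← h6, ← this]
      congr 2 <;> ring
    have := (el_inj.mp (ι_injective h5)).1
    linarith
  · intro c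
    constructor
    · intro hc
      obtain ⟨j, hj⟩ := haim c hc
      obtain ⟨m, hm⟩ : ∃ m : ℤ, c - (j : 𝓞 E) • τ₀ = m := by
        apply re_eq_intCast_of_im_eq_zero h1 hmin (J.sub_mem hc (J.smul_mem _ hτ₀))
        rw [Algebra.smul_def, map_intCast]
        simp [QuadraticAlgebra.re_intCast, QuadraticAlgebra.im_intCast, hj]
      refine ⟨m * a + j * el n 1, ?_, ?_⟩
      · exact Ideal.mem_span_pair.mpr ⟨m, j, rfl⟩
      · rw [Algebra.smul_def, map_intCast, sub_eq_iff_eq_add] at hm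
        rw [hm, map_add, map_mul, map_mul, ← haτ]
        simp only [map_intCast]
        ring
    · rintro ⟨z, hz, hcz⟩
      obtain ⟨x, y, rfl⟩ := Ideal.mem_span_pair.mp hz
      have : c = x • (1 : E) + y • τ₀ := by
        apply mul_left_cancel₀ haE
        rw [hcz, Algebra.smul_def, Algebra.smul_def, map_add, map_mul, map_mul, ← haτ, map_intCast]
        ring
      rw [this]
      exact J.add_mem (J.smul_mem _ h1) (J.smul_mem _ hτ₀)

theorem exists_eq_mul_P_of_eq_Q {J : Submodule (𝓞 E) E} (i : Fin 6) {n : ℤ}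
    (hn : (p i : ℤ) ∣ n ^ 2 + n + 22) (hni : (p i : ℤ) ∣ shift i - n)
    (hJ : ∀ c : E, c ∈ J ↔ ∃ z ∈ Q (p i) n, (p i : E) * c = ι z) :
    ∃ (i : Fin 6) (β : E), β ≠ 0 ∧ ∀ c : E, c ∈ J ↔ ∃ z ∈ P i, c = β * ι z := by
  have hp : (p i : E) ≠ 0 := by exact_mod_cast (p_pos i).ne'
  refine ⟨i, (p i : E)⁻¹, inv_ne_zero hp, fun c => ?_⟩
  rw [hJ, Q_congr hn hni, ← P_eq_Q]
  simp only [eq_inv_mul_iff_mul_eq₀ hp]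

/-- No representative has norm 4, so `(4, n + ω)` is moved to an ideal of norm 7. The hypotheses
`h1` and `h2` say `7 (4, n + ω) = (s + t ω) P i`. -/
theorem exists_eq_mul_P_of_eq_Q_four {J : Submodule (𝓞 E) E} (i : Fin 6) (n s t : ℤ)
    (hst : el s t ≠ 0)
    (h1 : ∀ z ∈ Q 4 n, ∃ w ∈ P i, 7 * z = el s t * w)
    (h2 : ∀ w ∈ P i, ∃ z ∈ Q 4 n, 7 * z = el s t * w)
    (hJ : ∀ c : E, c ∈ J ↔ ∃ z ∈ Q 4 n, (4 : E) * c = ι z) :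
    ∃ (i : Fin 6) (β : E), β ≠ 0 ∧ ∀ c : E, c ∈ J ↔ ∃ z ∈ P i, c = β * ι z := by
  have hβ : ι (el s t) ≠ 0 := fun h => hst (ι_injective (by rw [h, map_zero]))
  refine ⟨i, ι (el s t) / 28, div_ne_zero hβ (by norm_num), fun c => ?_⟩
  rw [hJ]
  constructor
  · rintro ⟨z, hz, hc⟩
    obtain ⟨w, hw, hzw⟩ := h1 z hz
    have := congrArg ι hzw
    rw [map_mul, map_mul, map_ofNat, ← hc] at this
    exact ⟨w, hw, by linear_combination this / 28⟩
  · rintro ⟨w, hw, rfl⟩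
    obtain ⟨z, hz, hzw⟩ := h2 w hw
    have := congrArg ι hzw
    rw [map_mul, map_mul, map_ofNat] at this
    exact ⟨z, hz, by linear_combination -this / 7⟩

/-- A lattice in `E` containing `1` as a vector of minimal norm is a multiple of some `𝔓ᵢ`. -/
theorem exists_eq_mul_P {J : Submodule (𝓞 E) E} (h1 : (1 : E) ∈ J)
    (hmin : ∀ c ∈ J, c ≠ 0 → 1 ≤ nm c) :
    ∃ (i : Fin 6) (β : E), β ≠ 0 ∧ ∀ c : E, c ∈ J ↔ ∃ z ∈ P i, c = β * ι z := by
  obtain ⟨a, n, ha, ha5, hdvd, hJ⟩ := exists_eq_inv_mul_Q h1 hmin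
  have e7 : (7 : 𝓞 E) = el 7 0 := by rw [← el_intCast]; norm_cast
  obtain rfl | rfl | rfl | rfl | rfl : a = 1 ∨ a = 2 ∨ a = 3 ∨ a = 4 ∨ a = 5 := by omega
  · refine exists_eq_mul_P_of_eq_Q 0 (n := n) (one_dvd _) (one_dvd _) ?_
    simpa [p] using hJ
  · rcases Int.even_or_odd' n with ⟨k, rfl | rfl⟩
    · refine exists_eq_mul_P_of_eq_Q 5 (n := 2 * k) ?_ ?_ ?_
      · simpa [p] using hdvd
      · simp [p, shift]
      · simpa [p] using hJ
    · refine exists_eq_mul_P_of_eq_Q 1 (n := 2 * k + 1) ?_ ?_ ?_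
      · simpa [p] using hdvd
      · simp only [p, shift, Matrix.cons_val]; omega
      · simpa [p] using hJ
  -- 3 is ramified: `n² + n + 22 ≡ (n - 1)²` modulo 3.
  · have hn : n % 3 = 1 := by
      obtain ⟨q, r, hr0, hr3, rfl⟩ : ∃ q r : ℤ, 0 ≤ r ∧ r < 3 ∧ n = 3 * q + r :=
        ⟨n / 3, n % 3, by omega, by omega, by omega⟩
      interval_cases r <;> ring_nf at hdvd <;> omega
    refine exists_eq_mul_P_of_eq_Q 3 (n := n) ?_ ?_ ?_
    · simpa [p] using hdvd
    · simp only [p, shift, Matrix.cons_val]; omega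
    · simpa [p] using hJ
  · obtain ⟨q, r, hr0, hr3, hqr⟩ : ∃ q r : ℤ, 0 ≤ r ∧ r < 4 ∧ n = 4 * q + r :=
        ⟨n / 4, n % 4, by omega, by omega, by omega⟩
    have hr : r = 1 ∨ r = 2 := by
      subst hqr
      interval_cases r <;> ring_nf at hdvd <;> omega
    have hmul : ∀ s t s' t' u v : ℤ, 7 * el u v = el s t * el s' t' ↔
        7 * u = s * s' - 22 * (t * t') ∧ 7 * v = s * t' + t * s' + t * t' := by
      intro s t s' t' u v
      rw [e7, el_mul, el_mul, el_inj]
      simp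
    rcases hr with rfl | rfl
    · rw [Q_congr hdvd (n' := 1) ⟨-q, by omega⟩] at hJ
      -- The multiplier `3 - ω` has norm `28 = 4 · 7`, as has `2 + ω` in the other case.
      refine exists_eq_mul_P_of_eq_Q_four 2 1 3 (-1)
        (by rw [el_zero, Ne, el_inj]; omega) ?_ ?_ (by simpa using hJ)
      · intro z hz
        obtain ⟨s, t, rfl⟩ := exists_el z
        obtain ⟨m, hm⟩ := (el_mem_Q (by norm_num) _ _).mp hz
        refine ⟨el (-5 * t + 2 * m) (t + m), (el_mem_P _ _ _).mpr ⟨-t, ?_⟩, (hmul ..).mpr ?_⟩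
        · simp only [p, shift, Matrix.cons_val]; push_cast; ring
        · constructor <;> linarith
      · intro w hw
        obtain ⟨s, t, rfl⟩ := exists_el w
        obtain ⟨m, hm⟩ := (el_mem_P _ _ _).mp hw
        simp only [p, shift, Matrix.cons_val] at hm
        push_cast at hm
        refine ⟨el (4 * t + 3 * m) (-m), (el_mem_Q (by norm_num) _ _).mpr ⟨t + m, by ring⟩,
          (hmul ..).mpr ?_⟩
        constructor <;> linarith
    · rw [Q_congr hdvd (n' := 2) ⟨-q, by omega⟩] at hJ
      refine exists_eq_mul_P_of_eq_Q_four 4 2 2 1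
        (by rw [el_zero, Ne, el_inj]; omega) ?_ ?_ (by simpa using hJ)
      · intro z hz
        obtain ⟨s, t, rfl⟩ := exists_el z
        obtain ⟨m, hm⟩ := (el_mem_Q (by norm_num) _ _).mp hz
        refine ⟨el (7 * t + 3 * m) (-m), (el_mem_P _ _ _).mpr ⟨t + m, ?_⟩, (hmul ..).mpr ?_⟩
        · simp only [p, shift, Matrix.cons_val]; push_cast; ring
        · constructor <;> linarith
      · intro w hw
        obtain ⟨s, t, rfl⟩ := exists_el w
        obtain ⟨m, hm⟩ := (el_mem_P _ _ _).mp hw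
        simp only [p, shift, Matrix.cons_val] at hm
        push_cast at hm
        refine ⟨el (2 * m - 2 * t) (m + t), (el_mem_Q (by norm_num) _ _).mpr ⟨-t, by ring⟩,
          (hmul ..).mpr ?_⟩
        constructor <;> linarith
  -- 5 is inert: `-87 ≡ 3` is not a square modulo 5, so `n² + n + 22` has no root.
  · exfalso
    obtain ⟨q, r, hr0, hr3, rfl⟩ : ∃ q r : ℤ, 0 ≤ r ∧ r < 5 ∧ n = 5 * q + r :=
        ⟨n / 5, n % 5, by omega, by omega, by omega⟩
    interval_cases r <;> ring_nf at hdvd <;> omega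

/-! ### The class group -/

theorem exists_nat_nm (z : 𝓞 E) : ∃ n : ℕ, nm (ι z) = n := by
  obtain ⟨s, t, rfl⟩ := exists_el z
  refine ⟨(s ^ 2 + s * t + 22 * t ^ 2).toNat, ?_⟩
  have : 0 ≤ s ^ 2 + s * t + 22 * t ^ 2 := by nlinarith [sq_nonneg (2 * s + t), sq_nonneg t]
  rw [nm_el]
  exact_mod_cast (Int.toNat_of_nonneg this).symm

theorem exists_mk0_P_eq (C : ClassGroup (𝓞 E)) :
    ∃ i : Fin 6, ClassGroup.mk0 ⟨P i, P_mem_nonZeroDivisors i⟩ = C := by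
  obtain ⟨⟨I, hI⟩, rfl⟩ := ClassGroup.mk0_surjective C
  choose N hN using exists_nat_nm
  obtain ⟨α, ⟨hα, hα0⟩, hαmin⟩ := (measure N).wf.has_min {z | z ∈ I ∧ z ≠ 0}
    (Submodule.exists_mem_ne_zero_of_ne_bot (mem_nonZeroDivisors_iff_ne_zero.mp hI))
  have hαE : ι α ≠ 0 := fun h => hα0 (ι_injective (by rw [h, map_zero]))
  let J : Submodule (𝓞 E) E :=
    (Submodule.map (Algebra.linearMap (𝓞 E) E) I).comap
      ((LinearMap.mulLeft E (ι α)).restrictScalars (𝓞 E))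
  have hJ : ∀ c, c ∈ J ↔ ∃ z ∈ I, ι z = ι α * c := fun c => Iff.rfl
  obtain ⟨i, β, hβ, h⟩ := exists_eq_mul_P (J := J) ((hJ 1).mpr ⟨α, hα, by simp⟩) (by
    intro c hc hc0
    obtain ⟨z, hz, hzc⟩ := (hJ c).mp hc
    have hz0 : z ≠ 0 := by
      rintro rfl
      rw [map_zero] at hzc
      exact mul_ne_zero hαE hc0 hzc.symm
    have h1 : N α ≤ N z := not_lt.mp (hαmin z ⟨hz, hz0⟩)
    have h2 : nm (ι α) * nm c = nm (ι z) := by rw [hzc, nm_mul]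
    have h3 : nm (ι α) ≤ nm (ι z) := by rw [hN, hN]; exact_mod_cast h1
    have h4 := nm_pos hαE
    rw [← h2] at h3
    exact le_of_mul_le_mul_left (by rwa [mul_one]) h4)
  obtain ⟨x, y, hy, hxy⟩ := IsFractionRing.div_surjective (A := 𝓞 E) (ι α * β)
  have hy0 : y ≠ 0 := nonZeroDivisors.ne_zero hy
  have hyE : ι y ≠ 0 := fun h => hy0 (ι_injective (by rw [h, map_zero]))
  have hx0 : x ≠ 0 := by
    rintro rfl
    rw [map_zero, zero_div] at hxy
    exact mul_ne_zero hαE hβ hxy.symm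
  have hβx : ι y * (ι α * β) = ι x := by rw [← hxy]; field_simp
  refine ⟨i, (ClassGroup.mk0_eq_mk0_iff).mpr ⟨x, y, hx0, hy0, ?_⟩⟩
  ext w
  simp only [Ideal.mem_span_singleton_mul]
  constructor
  · rintro ⟨z, hz, rfl⟩
    obtain ⟨v, hv, hvz⟩ := (hJ _).mp ((h (β * ι z)).mpr ⟨z, hz, rfl⟩)
    refine ⟨v, hv, ι_injective ?_⟩
    rw [map_mul, map_mul, hvz, ← hβx]; ring
  · rintro ⟨z, hz, rfl⟩
    obtain ⟨v, hv, hvz⟩ := (h (ι z / ι α)).mp ((hJ _).mpr ⟨z, hz, by field_simp⟩)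
    refine ⟨v, hv, ι_injective ?_⟩
    rw [map_mul, map_mul, ← hβx]
    rw [div_eq_iff hαE] at hvz
    rw [hvz]; ring

/-- A vector of minimal norm in `𝔓ᵢ`, unique up to sign. -/
noncomputable def minVec : Fin 6 → 𝓞 E := ![el 1 0, el 2 0, el 2 1, el 3 0, el (-3) 1, el 2 0]

theorem minVec_mem (i : Fin 6) : minVec i ∈ P i := by
  fin_cases i <;> exact (el_mem_P _ _ _).mpr (by decide)

theorem minVec_ne_zero (i : Fin 6) : minVec i ≠ 0 := by
  rw [el_zero]
  fin_cases i <;> simp [minVec, el_inj]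

/-- The minimal norms are at most 28, which bounds the coordinates by `|t| ≤ 1` and `|s| ≤ 5` and
leaves a finite check. -/
theorem eq_or_eq_neg_minVec (i : Fin 6) {z : 𝓞 E} (hz : z ∈ P i) (hz0 : z ≠ 0)
    (h : nm (ι z) ≤ nm (ι (minVec i))) : z = minVec i ∨ z = -minVec i := by
  obtain ⟨s, t, rfl⟩ := exists_el z
  rw [el_mem_P] at hz
  rw [Ne, el_zero, el_inj] at hz0
  rw [nm_el] at h
  have hb : ∀ M : ℤ, s ^ 2 + s * t + 22 * t ^ 2 ≤ M → M ≤ 28 →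
      -1 ≤ t ∧ t ≤ 1 ∧ -5 ≤ s ∧ s ≤ 5 := by
    intro M h1 h2
    have h3 : -1 ≤ t ∧ t ≤ 1 := by
      constructor <;> nlinarith [sq_nonneg (2 * s + t)]
    refine ⟨h3.1, h3.2, ?_, ?_⟩ <;> nlinarith [sq_nonneg (2 * s + t), sq_nonneg t]
  have key : ∀ u v : ℤ, minVec i = el u v → u ^ 2 + u * v + 22 * v ^ 2 ≤ 28 →
      (∀ s' ∈ Finset.Icc (-5 : ℤ) 5, ∀ t' ∈ Finset.Icc (-1 : ℤ) 1,
        s' ^ 2 + s' * t' + 22 * t' ^ 2 ≤ u ^ 2 + u * v + 22 * v ^ 2 →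
        (p i : ℤ) ∣ s' - shift i * t' →
        (s' = 0 ∧ t' = 0) ∨ (s' = u ∧ t' = v) ∨ (s' = -u ∧ t' = -v)) →
      el s t = minVec i ∨ el s t = -minVec i := by
    intro u v hi hM hd
    rw [hi, nm_el] at h
    have h' : s ^ 2 + s * t + 22 * t ^ 2 ≤ u ^ 2 + u * v + 22 * v ^ 2 := by exact_mod_cast h
    obtain ⟨h1, h2, h3, h4⟩ := hb _ h' hM
    rw [hi, el_neg, el_inj, el_inj]
    exact (hd s (by simp; omega) t (by simp; omega) h' hz).resolve_left hz0
  fin_cases i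
  · exact key 1 0 rfl (by norm_num) (by decide)
  · exact key 2 0 rfl (by norm_num) (by decide)
  · exact key 2 1 rfl (by norm_num) (by decide)
  · exact key 3 0 rfl (by norm_num) (by decide)
  · exact key (-3) 1 rfl (by norm_num) (by decide)
  · exact key 2 0 rfl (by norm_num) (by decide)

/-- If `x P i = y P j`, multiplication by `x / y` carries minimal vectors to minimal vectors. By
uniqueness `x / y = ± minVec j / minVec i`, which removes the unknown `x` and `y`. -/
theorem mul_minVec_of_mk0_eq {i j : Fin 6}
    (h : ClassGroup.mk0 ⟨P i, P_mem_nonZeroDivisors i⟩ =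
      ClassGroup.mk0 ⟨P j, P_mem_nonZeroDivisors j⟩) :
    ∀ z ∈ P i, ∃ w ∈ P j, z * minVec j = minVec i * w := by
  obtain ⟨x, y, hx, hy, hxy⟩ := ClassGroup.mk0_eq_mk0_iff.mp h
  have h1 : ∀ z ∈ P i, ∃ w ∈ P j, x * z = y * w := by
    intro z hz
    have : x * z ∈ Ideal.span {y} * P j := by
      rw [← hxy]; exact Ideal.mem_span_singleton_mul.mpr ⟨z, hz, rfl⟩
    obtain ⟨w, hw, e⟩ := Ideal.mem_span_singleton_mul.mp this
    exact ⟨w, hw, e.symm⟩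
  have h2 : ∀ z ∈ P j, ∃ w ∈ P i, y * z = x * w := by
    intro z hz
    have : y * z ∈ Ideal.span {x} * P i := by
      rw [hxy]; exact Ideal.mem_span_singleton_mul.mpr ⟨z, hz, rfl⟩
    obtain ⟨w, hw, e⟩ := Ideal.mem_span_singleton_mul.mp this
    exact ⟨w, hw, e.symm⟩
  have hne : ∀ z : 𝓞 E, z ≠ 0 → ι z ≠ 0 := fun z hz h =>
    hz (ι_injective (by rw [h, map_zero]))
  obtain ⟨w, hw, hxw⟩ := h1 _ (minVec_mem i)
  obtain ⟨w', hw', hyw⟩ := h2 _ (minVec_mem j)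
  have hw0 : w ≠ 0 := by
    rintro rfl; rw [mul_zero] at hxw; exact mul_ne_zero hx (minVec_ne_zero i) hxw
  have hw0' : w' ≠ 0 := by
    rintro rfl; rw [mul_zero] at hyw; exact mul_ne_zero hy (minVec_ne_zero j) hyw
  have hle : nm (ι w) ≤ nm (ι (minVec j)) := by
    by_contra hlt
    push Not at hlt
    have hlt' : nm (ι w') < nm (ι (minVec i)) := by
      have e1 : nm (ι x) * nm (ι (minVec i)) = nm (ι y) * nm (ι w) := by
        rw [← nm_mul, ← nm_mul, ← map_mul, ← map_mul, hxw]
      have e2 : nm (ι y) * nm (ι (minVec j)) = nm (ι x) * nm (ι w') := by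
        rw [← nm_mul, ← nm_mul, ← map_mul, ← map_mul, hyw]
      have px := nm_pos (hne x hx)
      have py := nm_pos (hne y hy)
      by_contra hge
      push Not at hge
      nlinarith
    rcases eq_or_eq_neg_minVec i hw' hw0' hlt'.le with rfl | rfl
    · exact lt_irrefl _ hlt'
    · rw [map_neg] at hlt'
      simp [nm] at hlt'
  intro z hz
  obtain ⟨v, hv, hzv⟩ := h1 z hz
  rcases eq_or_eq_neg_minVec j hw hw0 hle with rfl | rfl
  · exact ⟨v, hv, mul_left_cancel₀ (mul_ne_zero hx hy)
      (by linear_combination y * minVec j * hzv - y * v * hxw)⟩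
  · exact ⟨-v, (P j).neg_mem hv, mul_left_cancel₀ (mul_ne_zero hx hy)
      (by linear_combination y * minVec j * hzv + y * v * hxw)⟩

theorem mk0_P_injective : Function.Injective
    fun i : Fin 6 => ClassGroup.mk0 ⟨P i, P_mem_nonZeroDivisors i⟩ := by
  intro i j h
  -- Tested on the two generators of each ideal, the inclusions become linear equations and
  -- congruences over `ℤ`, unsolvable when `i ≠ j`.
  have h1 := mul_minVec_of_mk0_eq h
  obtain ⟨w1, hw1, e1⟩ := h1 (el (p i) 0) ((el_mem_P _ _ _).mpr (by simp))
  obtain ⟨w2, hw2, e2⟩ := h1 (el (shift i) 1) ((el_mem_P _ _ _).mpr (by simp))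
  obtain ⟨s1, t1, rfl⟩ := exists_el w1
  obtain ⟨s2, t2, rfl⟩ := exists_el w2
  rw [el_mem_P] at hw1 hw2
  obtain ⟨w3, hw3, e3⟩ := mul_minVec_of_mk0_eq h.symm (el (shift j) 1)
    ((el_mem_P _ _ _).mpr (by simp))
  obtain ⟨s3, t3, rfl⟩ := exists_el w3
  obtain ⟨w4, hw4, e4⟩ := mul_minVec_of_mk0_eq h.symm (el (p j) 0)
    ((el_mem_P _ _ _).mpr (by simp))
  obtain ⟨s4, t4, rfl⟩ := exists_el w4
  clear h1 h hw3 hw4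
  revert e1 e2 e3 e4 hw1 hw2
  fin_cases i <;> fin_cases j <;>
    simp only [p, shift, minVec, Matrix.cons_val, el_mul, el_inj, Fin.reduceFinMk,
      Fin.zero_eta, Fin.mk_one, Fin.isValue] <;> first | (intros; trivial) | (push_cast; intros; omega)

theorem existsUnique_mk0_P (C : ClassGroup (𝓞 E)) :
    ∃! i : Fin 6, ∃ hi : P i ∈ (Ideal (𝓞 E))⁰, ClassGroup.mk0 ⟨P i, hi⟩ = C := by
  obtain ⟨i, hi⟩ := exists_mk0_P_eq C
  refine ⟨i, ⟨P_mem_nonZeroDivisors i, hi⟩, ?_⟩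
  rintro j ⟨hj, hjC⟩
  exact mk0_P_injective (hjC.trans hi.symm)

theorem classNumber_eq : NumberField.classNumber E = 6 := by
  rw [NumberField.classNumber, ← Fintype.card_of_bijective
    ⟨mk0_P_injective, exists_mk0_P_eq⟩, Fintype.card_fin]

/-! ### Four squares with congruence conditions -/

section FourSquares

theorem exists_four_squares {N : ℤ} (hN : 0 ≤ N) :
    ∃ a b c d : ℤ, a ^ 2 + b ^ 2 + c ^ 2 + d ^ 2 = N := by
  obtain ⟨a, b, c, d, h⟩ := Nat.sum_four_squares N.toNat
  refine ⟨a, b, c, d, ?_⟩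
  have : ((a ^ 2 + b ^ 2 + c ^ 2 + d ^ 2 : ℕ) : ℤ) = N := by
    rw [h]; exact Int.toNat_of_nonneg hN
  exact_mod_cast this

theorem sq_emod_eight (z : ℤ) : (z % 4 = 0 ∧ z ^ 2 % 8 = 0) ∨ (z % 4 = 2 ∧ z ^ 2 % 8 = 4) ∨
    (z % 2 = 1 ∧ z ^ 2 % 8 = 1) := by
  have h : z % 8 = 0 ∨ z % 8 = 1 ∨ z % 8 = 2 ∨ z % 8 = 3 ∨ z % 8 = 4 ∨ z % 8 = 5 ∨ z % 8 = 6 ∨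
    z % 8 = 7 := by omega
  rcases h with h | h | h | h | h | h | h | h <;> simp [pow_two, Int.mul_emod, h] <;> omega

theorem sq_emod_four (z : ℤ) : (∃ k, z = 2 * k ∧ z ^ 2 % 4 = 0) ∨ (z % 2 = 1 ∧ z ^ 2 % 4 = 1) := by
  rcases sq_emod_eight z with h | h | h
  · exact Or.inl ⟨z / 2, by omega, by omega⟩
  · exact Or.inl ⟨z / 2, by omega, by omega⟩
  · exact Or.inr ⟨h.1, by omega⟩

/-- Squares are 0, 1 or 4 modulo 8, so a sum congruent to 3 has exactly three odd terms and a fourth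
divisible by 8. -/
theorem exists_four_squares_of_emod_eight_eq_three {N : ℤ} (hN : 0 ≤ N) (h : N % 8 = 3) :
    ∃ a b c d : ℤ, a % 2 = 1 ∧ b % 2 = 1 ∧ c % 2 = 1 ∧
      a ^ 2 + b ^ 2 + c ^ 2 + (4 * d) ^ 2 = N := by
  obtain ⟨a, b, c, d, rfl⟩ := exists_four_squares hN
  have key : (a % 4 = 0 ∧ b % 2 = 1 ∧ c % 2 = 1 ∧ d % 2 = 1) ∨
      (b % 4 = 0 ∧ a % 2 = 1 ∧ c % 2 = 1 ∧ d % 2 = 1) ∨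
      (c % 4 = 0 ∧ a % 2 = 1 ∧ b % 2 = 1 ∧ d % 2 = 1) ∨
      (d % 4 = 0 ∧ a % 2 = 1 ∧ b % 2 = 1 ∧ c % 2 = 1) := by
    have ha := sq_emod_eight a
    have hb := sq_emod_eight b
    have hc := sq_emod_eight c
    have hd := sq_emod_eight d
    generalize a ^ 2 = a' at *
    generalize b ^ 2 = b' at *
    generalize c ^ 2 = c' at *
    generalize d ^ 2 = d' at *
    rcases ha with ha | ha | ha <;> rcases hb with hb | hb | hb <;>
      rcases hc with hc | hc | hc <;> rcases hd with hd | hd | hd <;> omega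
  rcases key with ⟨h1, h2, h3, h4⟩ | ⟨h1, h2, h3, h4⟩ | ⟨h1, h2, h3, h4⟩ | ⟨h1, h2, h3, h4⟩
  · obtain ⟨k, rfl⟩ := Int.dvd_of_emod_eq_zero h1
    exact ⟨b, c, d, k, h2, h3, h4, by ring⟩
  · obtain ⟨k, rfl⟩ := Int.dvd_of_emod_eq_zero h1
    exact ⟨a, c, d, k, h2, h3, h4, by ring⟩
  · obtain ⟨k, rfl⟩ := Int.dvd_of_emod_eq_zero h1
    exact ⟨a, b, d, k, h2, h3, h4, by ring⟩
  · obtain ⟨k, rfl⟩ := Int.dvd_of_emod_eq_zero h1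
    exact ⟨a, b, c, k, h2, h3, h4, by ring⟩

theorem exists_four_squares_of_emod_four_eq_one {N : ℤ} (hN : 0 ≤ N) (h : N % 4 = 1) :
    ∃ a b c d : ℤ, (2 * a + 1) ^ 2 + (2 * b) ^ 2 + (2 * c) ^ 2 + (2 * d) ^ 2 = N := by
  have aux : ∀ a b c d : ℤ, a % 2 = 1 → a ^ 2 + (2 * b) ^ 2 + (2 * c) ^ 2 + (2 * d) ^ 2 = N →
      ∃ a b c d : ℤ, (2 * a + 1) ^ 2 + (2 * b) ^ 2 + (2 * c) ^ 2 + (2 * d) ^ 2 = N := by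
    intro a b c d ha h
    exact ⟨a / 2, b, c, d, by rw [show 2 * (a / 2) + 1 = a by omega, h]⟩
  obtain ⟨a, b, c, d, rfl⟩ := exists_four_squares hN
  rcases sq_emod_four a with ⟨a', rfl, ha⟩ | ha <;> rcases sq_emod_four b with ⟨b', rfl, hb⟩ | hb <;>
    rcases sq_emod_four c with ⟨c', rfl, hc⟩ | hc <;>
    rcases sq_emod_four d with ⟨d', rfl, hd⟩ | hd <;>
    first
    | omega
    | exact aux a b' c' d' ha.1 (by ring)
    | exact aux b a' c' d' hb.1 (by ring)
    | exact aux c a' b' d' hc.1 (by ring)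
    | exact aux d a' b' c' hd.1 (by ring)

theorem exists_four_squares_of_emod_four_eq_two {N : ℤ} (hN : 0 ≤ N) (h : N % 4 = 2) :
    ∃ a b c d : ℤ, (2 * a + 1) ^ 2 + (2 * b + 1) ^ 2 + (2 * c) ^ 2 + (2 * d) ^ 2 = N := by
  have aux : ∀ a b c d : ℤ, a % 2 = 1 → b % 2 = 1 →
      a ^ 2 + b ^ 2 + (2 * c) ^ 2 + (2 * d) ^ 2 = N →
      ∃ a b c d : ℤ, (2 * a + 1) ^ 2 + (2 * b + 1) ^ 2 + (2 * c) ^ 2 + (2 * d) ^ 2 = N := by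
    intro a b c d ha hb h
    exact ⟨a / 2, b / 2, c, d, by
      rw [show 2 * (a / 2) + 1 = a by omega, show 2 * (b / 2) + 1 = b by omega, h]⟩
  obtain ⟨a, b, c, d, rfl⟩ := exists_four_squares hN
  rcases sq_emod_four a with ⟨a', rfl, ha⟩ | ha <;> rcases sq_emod_four b with ⟨b', rfl, hb⟩ | hb <;>
    rcases sq_emod_four c with ⟨c', rfl, hc⟩ | hc <;>
    rcases sq_emod_four d with ⟨d', rfl, hd⟩ | hd <;>
    first
    | omega
    | exact aux a b c' d' ha.1 hb.1 (by ring)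
    | exact aux a c b' d' ha.1 hc.1 (by ring)
    | exact aux a d b' c' ha.1 hd.1 (by ring)
    | exact aux b c a' d' hb.1 hc.1 (by ring)
    | exact aux b d a' c' hb.1 hd.1 (by ring)
    | exact aux c d a' b' hc.1 hd.1 (by ring)

/-- In a representation of the odd number `N / 4` the sum `a + b + c + d` is odd. The four signed
sums below are then all odd, and their squares add up to `4 (N / 4)`. -/
theorem exists_four_squares_of_emod_eight_eq_four {N : ℤ} (hN : 0 ≤ N) (h : N % 8 = 4) :
    ∃ a b c d : ℤ, a % 2 = 1 ∧ b % 2 = 1 ∧ c % 2 = 1 ∧ d % 2 = 1 ∧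
      a ^ 2 + b ^ 2 + c ^ 2 + d ^ 2 = N := by
  obtain ⟨a, b, c, d, h'⟩ := exists_four_squares (N := N / 4) (by omega)
  have hpar : (a + b + c + d) % 2 = 1 := by
    have ha := sq_emod_eight a
    have hb := sq_emod_eight b
    have hc := sq_emod_eight c
    have hd := sq_emod_eight d
    omega
  refine ⟨a + b + c + d, a + b - c - d, a - b + c - d, a - b - c + d, by omega, by omega,
    by omega, by omega, ?_⟩
  have : N = 4 * (N / 4) := by omega
  rw [this, ← h']; ring

/-- An odd square is the square of an integer in a given odd residue class modulo `4`. -/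
theorem exists_sq_eq_sq_of_odd {z k : ℤ} (hz : z % 2 = 1) (hk : k % 2 = 1) :
    ∃ x : ℤ, z ^ 2 = (4 * x + k) ^ 2 := by
  rcases (by omega : (z - k) % 4 = 0 ∨ (-z - k) % 4 = 0) with h | h
  · exact ⟨(z - k) / 4, by rw [show 4 * ((z - k) / 4) + k = z by omega]⟩
  · exact ⟨(-z - k) / 4, by rw [show 4 * ((-z - k) / 4) + k = -z by omega]; ring⟩

end FourSquares

/-! ### Sums of four values of the reduced forms -/

/-- `r` is a sum of four values of the binary form `f`. -/
def IsSumFour (f : ℤ → ℤ → ℤ) (r : ℤ) : Prop :=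
  ∃ x y : Fin 4 → ℤ, ∑ j, f (x j) (y j) = r

theorem IsSumFour.mk {f : ℤ → ℤ → ℤ} {r : ℤ} (x₁ y₁ x₂ y₂ x₃ y₃ x₄ y₄ : ℤ)
    (h : f x₁ y₁ + f x₂ y₂ + f x₃ y₃ + f x₄ y₄ = r) : IsSumFour f r :=
  ⟨![x₁, x₂, x₃, x₄], ![y₁, y₂, y₃, y₄], by
    rw [← h, Fin.sum_univ_four]; simp⟩

theorem IsSumFour.of_subst {f g : ℤ → ℤ → ℤ} (φ ψ : ℤ → ℤ → ℤ)
    (h : ∀ x y, g (φ x y) (ψ x y) = f x y) {r : ℤ} (hr : IsSumFour f r) : IsSumFour g r := by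
  obtain ⟨x, y, rfl⟩ := hr
  exact ⟨fun j => φ (x j) (y j), fun j => ψ (x j) (y j), by simp only [h]⟩

theorem isSumFour_one_one_twentyTwo {r : ℤ} (hr : 0 ≤ r) :
    IsSumFour (fun x y => x ^ 2 + x * y + 22 * y ^ 2) r := by
  obtain ⟨a, b, c, d, rfl⟩ := exists_four_squares hr
  exact .mk a 0 b 0 c 0 d 0 (by ring)

theorem isSumFour_two_one_eleven {r : ℤ} (hr : 0 ≤ r) (h1 : r ≠ 1) (h3 : r ≠ 3) (h5 : r ≠ 5)
    (h7 : r ≠ 7) (h9 : r ≠ 9) :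
    IsSumFour (fun x y => 2 * x ^ 2 + x * y + 11 * y ^ 2) r := by
  rcases Int.even_or_odd' r with ⟨m, rfl | rfl⟩
  · obtain ⟨a, b, c, d, h⟩ := exists_four_squares (N := m) (by omega)
    exact .mk a 0 b 0 c 0 d 0 (by rw [← h]; ring)
  by_cases hm : 16 ≤ m
  -- At `y = 1` the form is `((4x + 1)² + 87) / 8`. Three such values and `2d²` add up to `r`
  -- exactly when three odd squares and `(4d)²` add up to `8r - 261`.
  · obtain ⟨a, b, c, d, ha, hb, hc, h⟩ := exists_four_squares_of_emod_eight_eq_three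
      (N := 8 * (2 * m + 1 - 33) + 3) (by omega) (by omega)
    obtain ⟨x, hx⟩ := exists_sq_eq_sq_of_odd ha (k := 1) rfl
    obtain ⟨y, hy⟩ := exists_sq_eq_sq_of_odd hb (k := 1) rfl
    obtain ⟨z, hz⟩ := exists_sq_eq_sq_of_odd hc (k := 1) rfl
    exact .mk x 1 y 1 z 1 d 0 (by linarith)
  · have hm5 : 5 ≤ m := by omega
    push Not at hm
    interval_cases m
    · exact .mk 0 1 0 0 0 0 0 0 (by norm_num)
    · exact .mk 0 1 1 0 0 0 0 0 (by norm_num)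
    · exact .mk 0 1 1 0 1 0 0 0 (by norm_num)
    · exact .mk 0 1 1 0 1 0 1 0 (by norm_num)
    · exact .mk 0 1 2 0 0 0 0 0 (by norm_num)
    · exact .mk 0 1 2 0 1 0 0 0 (by norm_num)
    · exact .mk 0 1 2 0 1 0 1 0 (by norm_num)
    · exact .mk (-2) 1 2 0 0 0 0 0 (by norm_num)
    · exact .mk 0 1 2 0 2 0 0 0 (by norm_num)
    · exact .mk 0 1 3 0 0 0 0 0 (by norm_num)
    · exact .mk 0 1 3 0 1 0 0 0 (by norm_num)

theorem isSumFour_three_three_eight {r : ℤ} (hr : 0 ≤ r) (h1 : r ≠ 1) (h2 : r ≠ 2) (h4 : r ≠ 4)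
    (h5 : r ≠ 5) (h7 : r ≠ 7) (h10 : r ≠ 10) (h13 : r ≠ 13) :
    IsSumFour (fun x y => 3 * x ^ 2 + 3 * x * y + 8 * y ^ 2) r := by
  obtain ⟨m, rfl | rfl | rfl⟩ : ∃ m, r = 3 * m ∨ r = 3 * m + 1 ∨ r = 3 * m + 2 :=
    ⟨r / 3, by omega⟩
  · obtain ⟨a, b, c, d, h⟩ := exists_four_squares (N := m) (by omega)
    exact .mk a 0 b 0 c 0 d 0 (by rw [← h]; ring)
  -- At `y = 1` the form is `(3(2x + 1)² + 29) / 4`, congruent to 2 modulo 3. The class of `r`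
  -- modulo 3 therefore fixes the number of second variables set to 1: two here, one in the next
  -- case.
  · obtain ⟨a, b, c, d, h⟩ := exists_four_squares_of_emod_four_eq_two
      (N := 4 * (m - 5) + 2) (by omega) (by omega)
    exact .mk a 1 b 1 c 0 d 0 (by linarith)
  · obtain ⟨a, b, c, d, h⟩ := exists_four_squares_of_emod_four_eq_one
      (N := 4 * (m - 2) + 1) (by omega) (by omega)
    exact .mk a 1 b 0 c 0 d 0 (by linarith)

theorem isSumFour_six_three_four {r : ℤ} (hr : 0 ≤ r) (h1 : r ≠ 1) (h2 : r ≠ 2) (h3 : r ≠ 3)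
    (h5 : r ≠ 5) (h9 : r ≠ 9) :
    IsSumFour (fun x y => 6 * x ^ 2 + 3 * x * y + 4 * y ^ 2) r := by
  obtain ⟨m, rfl | rfl | rfl⟩ : ∃ m, r = 3 * m ∨ r = 3 * m + 1 ∨ r = 3 * m + 2 :=
    ⟨r / 3, by omega⟩
  · by_cases hm : 4 ≤ m
    -- At `y = 1` the form is `(3(4x + 1)² + 29) / 8`, congruent to 1 modulo 3: three such values
    -- serve `r = 3m`, four serve `r = 3m + 1`.
    · obtain ⟨a, b, c, d, ha, hb, hc, h⟩ := exists_four_squares_of_emod_eight_eq_three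
        (N := 8 * m - 29) (by omega) (by omega)
      obtain ⟨x, hx⟩ := exists_sq_eq_sq_of_odd ha (k := 1) rfl
      obtain ⟨y, hy⟩ := exists_sq_eq_sq_of_odd hb (k := 1) rfl
      obtain ⟨z, hz⟩ := exists_sq_eq_sq_of_odd hc (k := 1) rfl
      exact .mk x 1 y 1 z 1 d 0 (by linarith)
    · obtain rfl | rfl : m = 0 ∨ m = 2 := by omega
      · exact .mk 0 0 0 0 0 0 0 0 (by norm_num)
      · exact .mk 1 0 0 0 0 0 0 0 (by norm_num)
  · by_cases hm : 5 ≤ m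
    · obtain ⟨a, b, c, d, ha, hb, hc, hd, h⟩ := exists_four_squares_of_emod_eight_eq_four
        (N := 8 * m - 36) (by omega) (by omega)
      obtain ⟨x, hx⟩ := exists_sq_eq_sq_of_odd ha (k := 1) rfl
      obtain ⟨y, hy⟩ := exists_sq_eq_sq_of_odd hb (k := 1) rfl
      obtain ⟨z, hz⟩ := exists_sq_eq_sq_of_odd hc (k := 1) rfl
      obtain ⟨w, hw⟩ := exists_sq_eq_sq_of_odd hd (k := 1) rfl
      exact .mk x 1 y 1 z 1 w 1 (by linarith)
    · obtain rfl | rfl | rfl | rfl : m = 1 ∨ m = 2 ∨ m = 3 ∨ m = 4 := by omega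
      · exact .mk 0 1 0 0 0 0 0 0 (by norm_num)
      · exact .mk 1 (-1) 0 0 0 0 0 0 (by norm_num)
      · exact .mk 1 0 0 1 0 0 0 0 (by norm_num)
      · exact .mk 1 1 0 0 0 0 0 0 (by norm_num)
  · by_cases hm : 13 ≤ m
    -- Two values at `y = 1` give the right class modulo 3, but with only two odd squares the even
    -- ones need not be divisible by 4. A third odd square comes from `y = 3`, where the form is
    -- `(3(4x + 3)² + 261) / 8`, a multiple of 3.
    · obtain ⟨a, b, c, d, ha, hb, hc, h⟩ := exists_four_squares_of_emod_eight_eq_three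
        (N := 8 * m - 101) (by omega) (by omega)
      obtain ⟨x, hx⟩ := exists_sq_eq_sq_of_odd ha (k := 3) rfl
      obtain ⟨y, hy⟩ := exists_sq_eq_sq_of_odd hb (k := 1) rfl
      obtain ⟨z, hz⟩ := exists_sq_eq_sq_of_odd hc (k := 1) rfl
      exact .mk x 3 y 1 z 1 d 0 (by linarith)
    · have hm2 : 2 ≤ m := by omega
      push Not at hm
      interval_cases m
      · exact .mk 0 1 0 1 0 0 0 0 (by norm_num)
      · exact .mk 1 (-1) 0 1 0 0 0 0 (by norm_num)
      · exact .mk 1 (-1) 1 (-1) 0 0 0 0 (by norm_num)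
      · exact .mk 1 1 0 1 0 0 0 0 (by norm_num)
      · exact .mk 0 2 0 1 0 0 0 0 (by norm_num)
      · exact .mk 0 2 1 (-1) 0 0 0 0 (by norm_num)
      · exact .mk 1 1 1 1 0 0 0 0 (by norm_num)
      · exact .mk 2 (-1) 1 (-1) 0 0 0 0 (by norm_num)
      · exact .mk 0 2 0 2 0 0 0 0 (by norm_num)
      · exact .mk 1 2 1 (-1) 0 0 0 0 (by norm_num)
      · exact .mk 2 1 0 1 0 0 0 0 (by norm_num)

/-! ### The norm forms of the `P i` and the excluded values -/

/-- The norm form of `𝔓ᵢ`, divided by `pᵢ`. -/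
def qf (i : Fin 6) (x y : ℤ) : ℤ :=
  p i * x ^ 2 + (2 * shift i + 1) * x * y + (![22, 11, 4, 8, 6, 11] : Fin 6 → ℤ) i * y ^ 2

theorem isSumFour_qf (i : Fin 6) (r : ℕ) (hr : r ∉ excluded i) : IsSumFour (qf i) r := by
  have h0 : (0 : ℤ) ≤ r := by positivity
  fin_cases i
  · refine (isSumFour_one_one_twentyTwo h0).of_subst (fun x _ => x) (fun _ y => y) ?_
    intro x y; simp [qf, p, shift]
  · simp [excluded] at hr
    refine (isSumFour_two_one_eleven h0 (by omega) (by omega) (by omega) (by omega)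
      (by omega)).of_subst (fun x _ => x) (fun _ y => -y) ?_
    intro x y; simp [qf, p, shift]
  · simp [excluded] at hr
    -- `7x² + 5xy + 4y²` is not reduced; the substitution carries it to `6x² + 3xy + 4y²`.
    refine (isSumFour_six_three_four h0 (by omega) (by omega) (by omega) (by omega)
      (by omega)).of_subst (fun x _ => -x) (fun x y => x + y) ?_
    intro x y; simp [qf, p, shift]; ring
  · simp [excluded] at hr
    refine (isSumFour_three_three_eight h0 (by omega) (by omega) (by omega) (by omega)
      (by omega) (by omega) (by omega)).of_subst (fun x _ => x) (fun _ y => y) ?_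
    intro x y; simp [qf, p, shift]
  · simp [excluded] at hr
    refine (isSumFour_six_three_four h0 (by omega) (by omega) (by omega) (by omega)
      (by omega)).of_subst (fun _ y => -y) (fun x y => x + y) ?_
    intro x y; simp [qf, p, shift]; ring
  · simp [excluded] at hr
    refine (isSumFour_two_one_eleven h0 (by omega) (by omega) (by omega) (by omega)
      (by omega)).of_subst (fun x _ => x) (fun _ y => y) ?_
    intro x y; simp [qf, p, shift]

theorem p_mul_qf (i : Fin 6) (x y : ℤ) :
    4 * p i * qf i x y = (2 * p i * x + (2 * shift i + 1) * y) ^ 2 + 87 * y ^ 2 := by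
  fin_cases i <;> simp [qf, p, shift] <;> ring

theorem qf_nonneg (i : Fin 6) (x y : ℤ) : 0 ≤ qf i x y := by
  have h := p_mul_qf i x y
  have hp : (0 : ℤ) < p i := by exact_mod_cast p_pos i
  by_contra hneg
  push Not at hneg
  nlinarith [sq_nonneg (2 * p i * x + (2 * shift i + 1) * y), sq_nonneg y]

theorem excluded_bounds : ∀ i : Fin 6, ∀ k ∈ excluded i, 0 < k ∧ k ≤ 13 := by decide

theorem qf_ne_of_mem_excluded (i : Fin 6) {k : ℕ} (hk : k ∈ excluded i) (x y : ℤ) :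
    qf i x y ≠ k := by
  intro h
  have hk13 : k ≤ 13 := (excluded_bounds i k hk).2
  have hk' : (k : ℤ) ≤ 13 := by exact_mod_cast hk13
  have h4 := p_mul_qf i x y
  rw [h] at h4
  have hp7 : (p i : ℤ) ≤ 7 := by exact_mod_cast (by decide : ∀ i, p i ≤ 7) i
  have hp0 : (0 : ℤ) < p i := by exact_mod_cast p_pos i
  -- `364 = 4 · 7 · 13`; completing the square then confines `x` and `y` to a box small enough for
  -- `decide`.
  have hbound : 4 * (p i : ℤ) * k ≤ 364 := by nlinarith
  have hy : -2 ≤ y ∧ y ≤ 2 := by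
    constructor <;> nlinarith [sq_nonneg (2 * p i * x + (2 * shift i + 1) * y)]
  have hX : -19 ≤ 2 * p i * x + (2 * shift i + 1) * y ∧
      2 * p i * x + (2 * shift i + 1) * y ≤ 19 := by
    constructor <;> nlinarith [sq_nonneg y]
  have hx : k ∈ excluded i → -6 ≤ x ∧ x ≤ 6 := by
    fin_cases i <;> simp only [p, shift, excluded, Matrix.cons_val, Fin.reduceFinMk,
      Fin.zero_eta, Fin.mk_one, Fin.isValue] at hX ⊢ <;> push_cast at hX <;>
      first | (intros; omega) | simp
  have hdec : ∀ i : Fin 6, ∀ x ∈ Finset.Icc (-6 : ℤ) 6, ∀ y ∈ Finset.Icc (-2 : ℤ) 2,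
      ∀ k ∈ excluded i, qf i x y ≠ k := by decide
  exact hdec i x (Finset.mem_Icc.mpr (hx hk)) y (Finset.mem_Icc.mpr hy) k hk h

/-- Single values avoid the excluded set, and the nonnegative integers outside it are closed under
addition, a finite check because excluded values are at most 13. -/
theorem sum_qf_ne_of_mem_excluded (i : Fin 6) {k : ℕ} (hk : k ∈ excluded i) {m : ℕ}
    (x y : Fin m → ℤ) : ∑ j, qf i (x j) (y j) ≠ k := by
  have h : 0 ≤ ∑ j, qf i (x j) (y j) ∧ ∀ k ∈ excluded i, ∑ j, qf i (x j) (y j) ≠ k := by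
    refine Finset.sum_induction (fun j => qf i (x j) (y j))
      (fun v : ℤ => 0 ≤ v ∧ ∀ k ∈ excluded i, v ≠ k) ?_ ?_ ?_
    · rintro a b ⟨ha0, ha⟩ ⟨hb0, hb⟩
      refine ⟨add_nonneg ha0 hb0, ?_⟩
      lift a to ℕ using ha0
      lift b to ℕ using hb0
      intro k hk hab
      have ha' : a ∉ excluded i := fun h => ha a h rfl
      have hb' : b ∉ excluded i := fun h => hb b h rfl
      have hab' : a + b = k := by exact_mod_cast hab
      clear ha hb hab
      subst hab'
      have hdec : ∀ i : Fin 6, ∀ k ∈ excluded i, k ≤ 13 ∧ ∀ a ∈ Finset.range 14,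
          a ≤ k → a ∉ excluded i → k - a ∈ excluded i := by decide
      obtain ⟨h13, hd⟩ := hdec i _ hk
      have := hd a (Finset.mem_range.mpr (by omega)) (by omega) ha'
      rw [Nat.add_sub_cancel_left] at this
      exact hb' this
    · refine ⟨le_rfl, fun k hk => ?_⟩
      have : k ≠ 0 := (excluded_bounds i k hk).1.ne'
      exact_mod_cast this.symm
    · exact fun j _ => ⟨qf_nonneg _ _ _, fun k hk => qf_ne_of_mem_excluded i hk _ _⟩
  exact h.2 k hk

theorem qf_zero_cases (x y : ℤ) : qf 0 x y = 0 ∨ qf 0 x y = 1 ∨ qf 0 x y = 4 ∨ 9 ≤ qf 0 x y := by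
  have h : qf 0 x y = x ^ 2 + x * y + 22 * y ^ 2 := by simp [qf, p, shift]
  by_cases hy : y = 0
  · subst hy
    rw [h]
    by_cases hx : -2 ≤ x ∧ x ≤ 2
    · obtain ⟨h1, h2⟩ := hx
      interval_cases x <;> simp
    · right; right; right
      rcases (by omega : x ≤ -3 ∨ 3 ≤ x) with h3 | h3 <;> nlinarith
  · right; right; right
    have : 1 ≤ y ^ 2 := by have := sq_nonneg y; have := pow_ne_zero 2 hy; omega
    nlinarith [sq_nonneg (2 * x + y)]

/-- Below 9 the form takes only the values 0, 1 and 4, so at least the four terms `4 + 1 + 1 + 1`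
are needed. -/
theorem three_lt_of_sum_qf_zero_eq_seven {m : ℕ} (x y : Fin m → ℤ)
    (h : ∑ j, qf 0 (x j) (y j) = 7) : 3 < m := by
  by_contra hm
  push Not at hm
  interval_cases m
  · simp at h
  · rw [Fin.sum_univ_one] at h
    have := qf_zero_cases (x 0) (y 0)
    omega
  · rw [Fin.sum_univ_two] at h
    have := qf_zero_cases (x 0) (y 0)
    have := qf_zero_cases (x 1) (y 1)
    omega
  · rw [Fin.sum_univ_three] at h
    have := qf_zero_cases (x 0) (y 0)
    have := qf_zero_cases (x 1) (y 1)
    have := qf_zero_cases (x 2) (y 2)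
    omega

/-! ### Classification of unary lattices -/

theorem mem_P_iff (i : Fin 6) (z : 𝓞 E) :
    z ∈ P i ↔ ∃ x y : ℤ, z = el (p i * x + shift i * y) y := by
  obtain ⟨s, t, rfl⟩ := exists_el z
  rw [el_mem_P]
  constructor
  · rintro ⟨k, hk⟩
    exact ⟨k, t, el_inj.mpr ⟨by linarith, rfl⟩⟩
  · rintro ⟨x, y, h⟩
    obtain ⟨rfl, rfl⟩ := el_inj.mp h
    exact ⟨x, by ring⟩

theorem shift_eq (i : Fin 6) :
    shift i ^ 2 + shift i + 22 = p i * (![22, 11, 4, 8, 6, 11] : Fin 6 → ℤ) i := by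
  fin_cases i <;> simp [p, shift]

theorem nm_el_eq_p_mul_qf (i : Fin 6) (x y : ℤ) :
    nm (ι (el (p i * x + shift i * y) y)) = p i * qf i x y := by
  rw [nm_el]
  have : (p i * x + shift i * y) ^ 2 + (p i * x + shift i * y) * y + 22 * y ^ 2 =
      p i * qf i x y := by
    rw [qf]; linear_combination y ^ 2 * shift_eq i
  rw [this]; push_cast; rfl

/-- One half of the identity that `P i` times its conjugate is `(p i)`. It gives both the
integrality of `lat` and the maps from `lat` into `I_m`. -/
theorem exists_mul_star_eq {i : Fin 6} {z w : 𝓞 E} (hz : z ∈ P i) (hw : w ∈ P i) :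
    ∃ u : 𝓞 E, ι z * star (ι w) = p i * ι u := by
  obtain ⟨x, y, rfl⟩ := (mem_P_iff i z).mp hz
  obtain ⟨x', y', rfl⟩ := (mem_P_iff i w).mp hw
  refine ⟨el (p i * x * x' + x * y' * (shift i + 1) + x' * y * shift i +
    y * y' * (![22, 11, 4, 8, 6, 11] : Fin 6 → ℤ) i) (y * x' - x * y'), ?_⟩
  have hp : (p i : E) = ι (el (p i) 0) := by rw [← el_intCast]; simp
  rw [star_el, hp, ← map_mul, ← map_mul, el_mul, el_mul]
  congr 1
  rw [el_inj]
  constructor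
  · linear_combination y * y' * shift_eq i
  · ring

theorem p_mem_P (i : Fin 6) : (p i : 𝓞 E) ∈ P i :=
  (mem_P_iff i _).mpr ⟨1, 0, by simp [el]⟩

theorem mem_lat {i : Fin 6} {r : ℕ} {x : E} :
    x ∈ (lat i r).lattice ↔ ∃ z ∈ P i, ι z = x := Iff.rfl

theorem lat_h (i : Fin 6) (r : ℕ) (x y : E) :
    (lat i r).h x y = algebraMap ℚ E ((r : ℚ) / p i) * (x * star y) := rfl

theorem algebraMap_div_p_mul (i : Fin 6) (r : ℕ) :
    algebraMap ℚ E ((r : ℚ) / p i) * p i = r := by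
  rw [map_div₀, map_natCast, map_natCast, div_mul_cancel₀]
  exact_mod_cast (p_pos i).ne'

theorem isPosDefIntegral_lat (i : Fin 6) {r : ℕ} (hr : 0 < r) : (lat i r).IsPosDefIntegral := by
  constructor
  · rintro x hx hx0
    obtain ⟨z, hz, rfl⟩ := mem_lat.mp hx
    obtain ⟨a, b, rfl⟩ := (mem_P_iff i z).mp hz
    have hpos : 0 < qf i a b := by
      have h1 := nm_pos hx0
      rw [nm_el_eq_p_mul_qf] at h1
      have h2 : (0 : ℚ) < p i := by exact_mod_cast p_pos i
      exact_mod_cast pos_of_mul_pos_right h1 h2.le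
    obtain ⟨n, hn⟩ := Int.eq_ofNat_of_zero_le hpos.le
    refine ⟨r * n, Nat.mul_pos hr (by omega), ?_⟩
    rw [lat_h, mul_star_self, nm_el_eq_p_mul_qf, hn, map_mul, ← mul_assoc, map_natCast,
      algebraMap_div_p_mul, Int.cast_natCast, map_natCast]
    exact (Nat.cast_mul r n).symm
  · rintro x hx y hy
    obtain ⟨z, hz, rfl⟩ := mem_lat.mp hx
    obtain ⟨w, hw, rfl⟩ := mem_lat.mp hy
    obtain ⟨u, hu⟩ := exists_mul_star_eq hz hw
    refine ⟨r * u, ?_⟩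
    rw [lat_h, hu, ← mul_assoc, algebraMap_div_p_mul]
    simp

theorem isPosDefIntegral_of_isIsometricTo {d : ℕ} [NeZero d] {L : HermitianLattice.{u} d}
    {K : HermitianLattice.{v} d} (h : L.IsIsometricTo K) (hK : K.IsPosDefIntegral) :
    L.IsPosDefIntegral := by
  obtain ⟨σ, hσ, hh⟩ := h
  constructor
  · intro x hx hx0
    obtain ⟨n, hn, e⟩ := hK.1 (σ ⟨x, hx⟩) (σ ⟨x, hx⟩).2 (fun h0 => hx0 (by
      have : σ ⟨x, hx⟩ = 0 := Subtype.ext h0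
      exact congrArg Subtype.val ((map_eq_zero_iff σ hσ.injective).mp this)))
    exact ⟨n, hn, by rw [← e]; exact (hh ⟨x, hx⟩ ⟨x, hx⟩).symm⟩
  · intro x hx y hy
    obtain ⟨z, hz⟩ := hK.2 (σ ⟨x, hx⟩) (σ ⟨x, hx⟩).2 (σ ⟨y, hy⟩) (σ ⟨y, hy⟩).2
    exact ⟨z, by rw [← hz]; exact (hh ⟨x, hx⟩ ⟨y, hy⟩).symm⟩

theorem isUnary_of_isIsometricTo_lat {L : HermitianLattice.{u} 87} {i : Fin 6} {r : ℕ}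
    (h : L.IsIsometricTo (lat i r)) : L.IsUnary := by
  obtain ⟨σ, hσ, -⟩ := h
  have hp : ι (p i : 𝓞 E) ≠ 0 := by
    rw [map_natCast]; exact_mod_cast (p_pos i).ne'
  obtain ⟨x₀, hx₀⟩ := hσ.surjective ⟨ι (p i : 𝓞 E), mem_lat.mpr ⟨_, p_mem_P i, rfl⟩⟩
  have hne : (x₀ : L.V) ≠ 0 := by
    intro h0
    have h1 : x₀ = 0 := Subtype.ext h0
    rw [h1, map_zero] at hx₀
    exact hp (congrArg Subtype.val hx₀).symm
  have hspan : Submodule.span E (L.lattice : Set L.V) = Submodule.span E {(x₀ : L.V)} := by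
    apply le_antisymm
    · rw [Submodule.span_le]
      intro x hx
      obtain ⟨z, hz, hzx⟩ := mem_lat.mp (σ ⟨x, hx⟩).2
      have h1 : (p i : 𝓞 E) • (⟨x, hx⟩ : L.lattice) = z • x₀ := by
        have h3 : (p i : 𝓞 E) • ι z = z • ι (p i : 𝓞 E) := by
          rw [Algebra.smul_def, Algebra.smul_def, mul_comm]
        apply hσ.injective
        rw [map_smul, map_smul, hx₀]
        apply Subtype.ext
        change (p i : 𝓞 E) • (σ ⟨x, hx⟩).1 = _
        rw [← hzx]
        exact h3
      have h2 : ι (p i : 𝓞 E) • x = ι z • (x₀ : L.V) := by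
        rw [algebraMap_smul, algebraMap_smul]
        exact congrArg Subtype.val h1
      refine Submodule.mem_span_singleton.mpr ⟨(ι (p i : 𝓞 E))⁻¹ * ι z, ?_⟩
      rw [mul_smul, ← h2, smul_smul, inv_mul_cancel₀ hp, one_smul]
    · exact Submodule.span_mono (Set.singleton_subset_iff.mpr x₀.2)
  rw [HermitianLattice.IsUnary, hspan, finrank_span_singleton hne]

/-- Every positive definite integral unary lattice is some `𝔓ᵢ vᵢ^r`. -/
theorem exists_isIsometricTo_lat {L : HermitianLattice.{u} 87} (hL : L.IsPosDefIntegral)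
    (hu : L.IsUnary) : ∃ (i : Fin 6) (r : ℕ), 0 < r ∧ L.IsIsometricTo (lat i r) := by
  have hex : ∃ n : ℕ, 0 < n ∧ ∃ x ∈ L.lattice, x ≠ 0 ∧ L.h x x = (n : E) := by
    obtain ⟨x, hx, hx0⟩ := Submodule.exists_mem_ne_zero_of_ne_bot (p := L.lattice) (by
      rintro h
      rw [HermitianLattice.IsUnary, h, Submodule.bot_coe, Submodule.span_zero_singleton,
        finrank_bot] at hu
      exact zero_ne_one hu)
    obtain ⟨n, hn, e⟩ := hL.1 x hx hx0
    exact ⟨n, hn, x, hx, hx0, e⟩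
  classical
  obtain ⟨hn, v, hv, hv0, hvv⟩ := Nat.find_spec hex
  have hmin := fun m => Nat.find_min' hex (m := m)
  generalize Nat.find hex = n at *
  have hsmul : ∀ a b : E, L.h (a • v) (b • v) = algebraMap ℚ E n * (a * star b) := by
    intro a b
    rw [LinearMap.map_smulₛₗ, LinearMap.map_smul, LinearMap.smul_apply, hvv, map_natCast]
    simp only [smul_eq_mul, starRingEnd_apply]; ring
  let J : Submodule (𝓞 E) E := L.lattice.comap
    ((LinearMap.toSpanSingleton E L.V v).restrictScalars (𝓞 E))
  have hJ : ∀ c : E, c ∈ J ↔ c • v ∈ L.lattice := fun c => Iff.rfl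
  obtain ⟨i, β, hβ, h⟩ := exists_eq_mul_P (J := J) ((hJ 1).mpr (by rwa [one_smul])) (by
    intro c hc hc0
    have hcv : c • v ≠ 0 := smul_ne_zero hc0 hv0
    obtain ⟨m, hm, e⟩ := hL.1 _ ((hJ c).mp hc) hcv
    have hnm : n ≤ m := hmin m ⟨hm, _, (hJ c).mp hc, hcv, e⟩
    rw [hsmul, mul_star_self, ← map_mul, ← map_natCast (algebraMap ℚ E) m] at e
    have e' : (n : ℚ) * nm c = m := (algebraMap ℚ E).injective e
    have hn' : (0 : ℚ) < n := by exact_mod_cast hn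
    have hnm' : (n : ℚ) ≤ m := by exact_mod_cast hnm
    rw [← e'] at hnm'
    exact le_of_mul_le_mul_left (by rwa [mul_one]) hn')
  have hspan : ∀ x ∈ L.lattice, ∃ c : E, c • v = x := by
    intro x hx
    have h1 := (finrank_eq_one_iff_of_nonzero'
      (⟨v, Submodule.subset_span hv⟩ : Submodule.span E (L.lattice : Set L.V))
      (fun h0 => hv0 (congrArg Subtype.val h0))).mp hu ⟨x, Submodule.subset_span hx⟩
    obtain ⟨c, hc⟩ := h1
    exact ⟨c, congrArg Subtype.val hc⟩
  set w : L.V := β • v with hw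
  have hw0 : w ≠ 0 := smul_ne_zero hβ hv0
  have hwL : ∀ x : L.V, x ∈ L.lattice ↔ ∃ z ∈ P i, ι z • w = x := by
    intro x
    constructor
    · intro hx
      obtain ⟨c, rfl⟩ := hspan x hx
      obtain ⟨z, hz, rfl⟩ := (h c).mp ((hJ c).mpr hx)
      exact ⟨z, hz, by rw [hw, smul_smul, mul_comm]⟩
    · rintro ⟨z, hz, rfl⟩
      rw [hw, smul_smul, mul_comm]
      exact (hJ _).mp ((h _).mpr ⟨z, hz, rfl⟩)
  have hww : ∀ a b : E, L.h (a • w) (b • w) = algebraMap ℚ E (n * nm β) * (a * star b) := by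
    intro a b
    rw [hw, smul_smul, smul_smul, hsmul, map_mul, ← mul_star_self, star_mul']; ring
  have hppos : (0 : ℚ) < p i := by exact_mod_cast p_pos i
  -- The inner product of `p i • w` and `(shift i + ω) • w` must lie in `𝓞 E`. Its `ω`-coordinate is
  -- `-(n · nm β · p i)`, so this number is an integer, namely `-r`.
  obtain ⟨r, hr0, hr⟩ : ∃ r : ℕ, 0 < r ∧ (n : ℚ) * nm β = r / p i := by
    obtain ⟨u, hu⟩ := hL.2 _ ((hwL _).mpr ⟨_, p_mem_P i, rfl⟩) _
      ((hwL _).mpr ⟨el (shift i) 1, (mem_P_iff i _).mpr ⟨0, 1, by simp⟩, rfl⟩)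
    obtain ⟨s, t, rfl⟩ := exists_el u
    have hu' : algebraMap ℚ E (n * nm β) * (ι (p i : 𝓞 E) * star (ι (el (shift i) 1))) =
        ι (el s t) := by rw [← hww]; exact hu
    rw [star_el, coe_el, coe_el, map_natCast, algebraMap_rat] at hu'
    have him := congrArg QuadraticAlgebra.im hu'
    simp only [QuadraticAlgebra.im_mul, QuadraticAlgebra.re_mul, QuadraticAlgebra.re_natCast,
      QuadraticAlgebra.im_natCast] at him
    have ht : (n : ℚ) * nm β * p i = -t := by
      push_cast at him; linarith
    have hpos : (0 : ℚ) < n * nm β * p i := by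
      have h1 : (0 : ℚ) < n := by exact_mod_cast hn
      have h2 := nm_pos hβ
      positivity
    have htpos : 0 < -t := by rw [ht] at hpos; exact_mod_cast hpos
    refine ⟨(-t).toNat, by omega, ?_⟩
    rw [eq_div_iff hppos.ne', ht]
    have : (((-t).toNat : ℤ) : ℚ) = ((-t : ℤ) : ℚ) := by rw [Int.toNat_of_nonneg htpos.le]
    rw [Int.cast_natCast] at this
    rw [this]; simp
  refine ⟨i, r, hr0, HermitianLattice.IsIsometricTo.symm ?_⟩
  let f : (lat i r).V →ₗ[𝓞 E] L.V :=
    ((LinearMap.toSpanSingleton E L.V w).restrictScalars (𝓞 E) : E →ₗ[𝓞 E] L.V)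
  have hfinj : Function.Injective f := fun x y hxy => smul_left_injective E hw0 hxy
  have hfh : ∀ x y : E, L.h (f x) (f y) = (lat i r).h x y := fun x y => by
    rw [lat_h, ← hr]
    exact hww x y
  refine ⟨f.restrict (p := (lat i r).lattice) (q := L.lattice) ?_, ⟨?_, ?_⟩, ?_⟩
  · rintro x hx
    obtain ⟨z, hz, rfl⟩ := mem_lat.mp hx
    exact (hwL _).mpr ⟨z, hz, rfl⟩
  · rintro ⟨x, hx⟩ ⟨y, hy⟩ hxy
    exact Subtype.ext (hfinj (congrArg Subtype.val hxy))
  · rintro ⟨x, hx⟩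
    obtain ⟨z, hz, hzx⟩ := (hwL x).mp hx
    exact ⟨⟨ι z, mem_lat.mpr ⟨z, hz, rfl⟩⟩, Subtype.ext hzx⟩
  · exact fun x y => hfh x.1 y.1

/-! ### Representations by `I_m` -/

theorem mem_I_lattice {m : ℕ} {v : Fin m → E} :
    v ∈ (HermitianLattice.I 87 m).lattice ↔ ∀ j, ∃ z : 𝓞 E, ι z = v j := by
  change v ∈ Submodule.span (𝓞 E) (Set.range fun i : Fin m => (Pi.single i 1 : Fin m → E)) ↔ _
  constructor
  · intro hv j
    induction hv using Submodule.span_induction with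
    | mem x hx =>
      obtain ⟨k, rfl⟩ := hx
      by_cases hkj : j = k
      · subst hkj; exact ⟨1, by simp⟩
      · exact ⟨0, by simp [hkj]⟩
    | zero => exact ⟨0, by simp⟩
    | add x y _ _ hx hy =>
      obtain ⟨a, ha⟩ := hx
      obtain ⟨b, hb⟩ := hy
      exact ⟨a + b, by rw [map_add, ha, hb]; rfl⟩
    | smul c x _ hx =>
      obtain ⟨a, ha⟩ := hx
      exact ⟨c * a, by rw [map_mul, ha, Pi.smul_apply, Algebra.smul_def]⟩
  · intro hv
    choose z hz using hv
    have : v = ∑ j, z j • (Pi.single j 1 : Fin m → E) := by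
      ext1 k
      rw [Finset.sum_apply, Finset.sum_eq_single k]
      · rw [Pi.smul_apply, Pi.single_eq_same, Algebra.smul_def, mul_one, hz]
      · intro b _ hb
        rw [Pi.smul_apply, Pi.single_eq_of_ne hb.symm, smul_zero]
      · simp
    rw [this]
    exact Submodule.sum_mem _ fun j _ => Submodule.smul_mem _ _ (Submodule.subset_span ⟨j, rfl⟩)

/-- `𝔓ᵢ vᵢ^r` is represented by `I_m` iff `r` is a sum of `m` values of the norm form of `𝔓ᵢ`. -/
theorem lat_isRepresentedBy_I_iff (i : Fin 6) {r : ℕ} (hr : 0 < r) (m : ℕ) :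
    (lat i r).IsRepresentedBy (HermitianLattice.I 87 m) ↔
      ∃ x y : Fin m → ℤ, ∑ j, qf i (x j) (y j) = r := by
  have hpE : (p i : E) ≠ 0 := by exact_mod_cast (p_pos i).ne'
  have hpQ : (p i : ℚ) ≠ 0 := by exact_mod_cast (p_pos i).ne'
  constructor
  · rintro ⟨σ, -, hh⟩
    let e₁ : (lat i r).lattice := ⟨ι (p i : 𝓞 E), mem_lat.mpr ⟨_, p_mem_P i, rfl⟩⟩
    let e₂ : (lat i r).lattice := ⟨ι (el (shift i) 1),
      mem_lat.mpr ⟨_, (mem_P_iff i _).mpr ⟨0, 1, by simp⟩, rfl⟩⟩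
    have he : el (shift i) 1 • e₁ = (p i : 𝓞 E) • e₂ := by
      apply Subtype.ext
      change el (shift i) 1 • ι (p i : 𝓞 E) = (p i : 𝓞 E) • ι (el (shift i) 1)
      rw [Algebra.smul_def, Algebra.smul_def, mul_comm]
    choose b hb using mem_I_lattice.mp (σ e₁).2
    choose c hc using mem_I_lattice.mp (σ e₂).2
    have hbc : ∀ j, el (shift i) 1 * b j = (p i : 𝓞 E) * c j := by
      intro j
      apply ι_injective
      rw [map_mul, map_mul, hb, hc, ← Algebra.smul_def, ← Algebra.smul_def]
      have := congrArg σ he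
      rw [map_smul, map_smul] at this
      exact congrFun (congrArg Subtype.val this) j
    choose s t hst using fun j => exists_el (b j)
    choose s' t' hst' using fun j => exists_el (c j)
    -- Each coordinate of `σ` is multiplication by `b j / p i`. As this sends `shift i + ω` to the
    -- integer `c j`, the conjugate of `b j` lies in `P i`, with coordinates `t' j` and `-t j`.
    refine ⟨t', fun j => -t j, ?_⟩
    have hnm : ∀ j, nm (ι (b j)) = p i * qf i (t' j) (-t j) := by
      intro j
      have h1 := hbc j
      have hp : (p i : 𝓞 E) = el (p i) 0 := by rw [← el_intCast]; simp
      rw [hst, hst', hp, el_mul, el_mul, el_inj] at h1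
      rw [← nm_el_eq_p_mul_qf, hst, nm_el, nm_el]
      congr 1
      have h2 : p i * t' j + shift i * -t j = s j + t j := by linarith [h1.2]
      rw [h2]; ring
    have h1 := hh e₁ e₁
    have h2 : (HermitianLattice.I 87 m).h (σ e₁ : (HermitianLattice.I 87 m).V) (σ e₁) =
        ∑ j, ι (b j) * star (ι (b j)) := by
      simp only [hb]
      exact HermitianLattice.I_h_apply 87 m _ _
    rw [h2] at h1
    have h3 : ∑ j, ι (b j) * star (ι (b j)) =
        algebraMap ℚ E ((p i : ℚ) * ((∑ j, qf i (t' j) (-t j) : ℤ) : ℚ)) := by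
      simp only [mul_star_self, hnm]
      rw [← map_sum, ← Finset.mul_sum, Int.cast_sum]
    have h4 : (lat i r).h (e₁ : (lat i r).V) e₁ = algebraMap ℚ E (p i * r) := by
      change algebraMap ℚ E ((r : ℚ) / p i) * (ι (p i : 𝓞 E) * star (ι (p i : 𝓞 E))) = _
      rw [map_natCast, star_natCast, ← mul_assoc, algebraMap_div_p_mul, map_mul, map_natCast,
        map_natCast, mul_comm]
    rw [h3, h4] at h1
    have h5 := mul_left_cancel₀ hpQ ((algebraMap ℚ E).injective h1)
    exact_mod_cast h5
  · rintro ⟨x, y, hxy⟩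
    let a : Fin m → 𝓞 E := fun j => el (p i * x j + shift i * y j) (y j)
    have ha : ∀ j, a j ∈ P i := fun j => (mem_P_iff i _).mpr ⟨x j, y j, rfl⟩
    -- The conjugate of `a j` divided by `p i` lies in the inverse of `P i`, so `f` has integral
    -- coordinates on the lattice.
    let f : (lat i r).V →ₗ[𝓞 E] (HermitianLattice.I 87 m).V :=
      ((LinearMap.toSpanSingleton E (Fin m → E) fun j => star (ι (a j)) / p i).restrictScalars
        (𝓞 E) : E →ₗ[𝓞 E] (Fin m → E))
    have hf : ∀ (z : E) (j : Fin m), (f z : Fin m → E) j = z * (star (ι (a j)) / p i) :=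
      fun z j => rfl
    have hfh : ∀ z w : E, (HermitianLattice.I 87 m).h (f z) (f w) = (lat i r).h z w := by
      intro z w
      have h1 : (HermitianLattice.I 87 m).h (f z) (f w) =
          ∑ j, (z * (star (ι (a j)) / p i)) * star (w * (star (ι (a j)) / p i)) :=
        HermitianLattice.I_h_apply 87 m _ _
      have h2 : ∀ j, (z * (star (ι (a j)) / p i)) * star (w * (star (ι (a j)) / p i)) =
          algebraMap ℚ E (qf i (x j) (y j) : ℤ) * (z * star w / p i) := by
        intro j
        have h3 : ι (a j) * star (ι (a j)) = p i * algebraMap ℚ E (qf i (x j) (y j) : ℤ) := by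
          rw [mul_star_self, nm_el_eq_p_mul_qf, map_mul, map_natCast]
        rw [star_mul', star_div₀, star_star, star_natCast]
        field_simp
        linear_combination z * star w * h3
      rw [h1, Finset.sum_congr rfl fun j _ => h2 j, ← Finset.sum_mul, ← map_sum, ← Int.cast_sum,
        hxy, lat_h, map_div₀, Int.cast_natCast, map_natCast, map_natCast]
      ring
    have hmaps : ∀ z ∈ (lat i r).lattice, f z ∈ (HermitianLattice.I 87 m).lattice := by
      intro z hz
      obtain ⟨z, hz', rfl⟩ := mem_lat.mp hz
      refine mem_I_lattice.mpr fun j => ?_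
      obtain ⟨u, hu⟩ := exists_mul_star_eq hz' (ha j)
      refine ⟨u, ?_⟩
      rw [hf, ← mul_div_assoc, hu, mul_div_cancel_left₀ _ hpE]
    have hf0 : ∀ z : E, f z = 0 → z = 0 := by
      intro z h1
      have h2 := hfh z z
      rw [h1, map_zero, lat_h, mul_star_self, ← map_mul, eq_comm] at h2
      have h3 : (r : ℚ) / p i * nm z = 0 := by
        apply (algebraMap ℚ E).injective
        rw [h2]; simp
      have h4 : (r : ℚ) / p i ≠ 0 := div_ne_zero (by exact_mod_cast hr.ne') hpQ
      exact nm_eq_zero.mp ((mul_eq_zero.mp h3).resolve_left h4)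
    refine ⟨f.restrict hmaps, ?_, fun z w => hfh z.1 w.1⟩
    rw [injective_iff_map_eq_zero]
    rintro ⟨z, hz⟩ h0
    exact Subtype.ext (hf0 z (congrArg Subtype.val h0))

/-! ### The set `frakS 87` and the g-invariant -/

theorem lat_isRepresentedBy_I_four {i : Fin 6} {r : ℕ} (hr : 0 < r) (hri : r ∉ excluded i) :
    (lat i r).IsRepresentedBy (HermitianLattice.I 87 4) :=
  (lat_isRepresentedBy_I_iff i hr 4).mpr (isSumFour_qf i r hri)

theorem mem_frakS_of_isIsometricTo {L : HermitianLattice.{u} 87} {i : Fin 6} {r : ℕ}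
    (hr : 0 < r) (hri : r ∉ excluded i) (h : L.IsIsometricTo (lat i r)) : L ∈ frakS.{u} 87 :=
  ⟨isPosDefIntegral_of_isIsometricTo h (isPosDefIntegral_lat i hr),
    isUnary_of_isIsometricTo_lat h, 4, by norm_num,
    h.trans_isRepresentedBy (lat_isRepresentedBy_I_four hr hri)⟩

theorem notMem_excluded_of_mem_frakS {L : HermitianLattice.{u} 87} {i : Fin 6} {r : ℕ}
    (h : L.IsIsometricTo (lat i r)) (hL : L ∈ frakS.{u} 87) : r ∉ excluded i := by
  intro hri
  obtain ⟨-, -, m, -, hm⟩ := hL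
  obtain ⟨x, y, hxy⟩ := (lat_isRepresentedBy_I_iff i (excluded_bounds i r hri).1 m).mp
    (h.symm.trans_isRepresentedBy hm)
  exact sum_qf_ne_of_mem_excluded i hri x y hxy

theorem frakS_eq : frakS.{u} 87 = {L | ∃ (i : Fin 6) (r : ℕ), 0 < r ∧ r ∉ excluded i ∧
    L.IsIsometricTo (lat i r)} := by
  ext L
  constructor
  · intro hL
    obtain ⟨i, r, hr, h⟩ := exists_isIsometricTo_lat hL.1 hL.2.1
    exact ⟨i, r, hr, notMem_excluded_of_mem_frakS h hL, h⟩
  · rintro ⟨i, r, hr, hri, h⟩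
    exact mem_frakS_of_isIsometricTo hr hri h

theorem compl_frakS_eq :
    {L : HermitianLattice.{u} 87 | L.IsPosDefIntegral ∧ L.IsUnary ∧ L ∉ frakS.{u} 87} =
      {L | ∃ (i : Fin 6) (r : ℕ), r ∈ excluded i ∧ L.IsIsometricTo (lat i r)} := by
  ext L
  constructor
  · rintro ⟨h1, h2, h3⟩
    obtain ⟨i, r, hr, h⟩ := exists_isIsometricTo_lat h1 h2
    exact ⟨i, r, by_contra fun hri => h3 (mem_frakS_of_isIsometricTo hr hri h), h⟩
  · rintro ⟨i, r, hri, h⟩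
    exact ⟨isPosDefIntegral_of_isIsometricTo h
      (isPosDefIntegral_lat i (excluded_bounds i r hri).1),
      isUnary_of_isIsometricTo_lat h, fun hL => notMem_excluded_of_mem_frakS h hL hri⟩

theorem isGInvariant_four : IsGInvariant.{u} 87 4 := by
  constructor
  · refine ⟨by norm_num, fun L hL => ?_⟩
    rw [frakS_eq] at hL
    obtain ⟨i, r, hr, hri, h⟩ := hL
    exact h.trans_isRepresentedBy (lat_isRepresentedBy_I_four hr hri)
  · rintro g ⟨-, hg⟩
    -- The extremal lattice is `𝓞 v` with `h(v, v) = 7`, lifted to universe `u`.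
    have h := HermitianLattice.uliftLattice_isIsometricTo.{u} (lat 0 7)
    have hrep := h.symm.trans_isRepresentedBy
      (hg _ (mem_frakS_of_isIsometricTo (by norm_num) (by decide) h))
    obtain ⟨x, y, hxy⟩ := (lat_isRepresentedBy_I_iff 0 (by norm_num) g).mp hrep
    exact three_lt_of_sum_qf_zero_eq_seven x y (by exact_mod_cast hxy)

end Field87

theorem mainTheorem6 :
    NumberField.classNumber (ImagQuadField 87) = 6 ∧
    (∀ i : Fin 6, i ≠ 0 → (Field87.P i).IsPrime) ∧
    (∀ i : Fin 6, Ideal.absNorm (Field87.P i) = Field87.p i) ∧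
    (∀ C : ClassGroup (𝓞 (ImagQuadField 87)), ∃! i : Fin 6,
      ∃ hi : Field87.P i ∈ (Ideal (𝓞 (ImagQuadField 87)))⁰,
        ClassGroup.mk0 ⟨Field87.P i, hi⟩ = C) ∧
    frakS.{u} 87 =
      {L | ∃ (i : Fin 6) (r : ℕ), 0 < r ∧ r ∉ Field87.excluded i ∧
        L.IsIsometricTo (Field87.lat i r)} ∧
    {L : HermitianLattice.{u} 87 | L.IsPosDefIntegral ∧ L.IsUnary ∧ L ∉ frakS.{u} 87} =
      {L | ∃ (i : Fin 6) (r : ℕ), r ∈ Field87.excluded i ∧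
        L.IsIsometricTo (Field87.lat i r)} ∧
    IsGInvariant.{u} 87 4 :=
  ⟨Field87.classNumber_eq, Field87.isPrime_P, Field87.absNorm_P, Field87.existsUnique_mk0_P,
    Field87.frakS_eq, Field87.compl_frakS_eq, Field87.isGInvariant_four⟩
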